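/- **Setting.** Let $n,p\in\mathbb N$, $\theta_0\in\mathbb R^n$, $\sigma>0$. The data are $y(t)=\phi(t)^T\theta_0+v(t)$, $t=1,\dots,N$, with $\phi(t)=[u(t-1),\dots,u(t-n)]^T$, where $v(1),v(2),\dots$ is zero-mean white noise (square integrable, pairwise uncorrelated) with variance $\sigma^2$, and the input $u$ is deterministic or, more generally, a random process independent of $v$. Write $Y=\Phi\theta_0+V$, where $\Phi\in\mathbb R^{N\times n}$ has rows $\phi(t)^T$. For a positive definite kernel matrix $P\in\mathbb R^{n\times n}$ put $$Q=\Phi P\Phi^T+\sigma^2I_N,\quad R=\Phi^T\Phi+\sigma^2P^{-1},\quad \hat\theta^{\rm LS}=(\Phi^T\Phi)^{-1}\Phi^TY,\quad \hat\theta^{\rm R}(P)=P\Phi^TQ^{-1}Y,$$ and consider the criteria - ${\rm MSEg}(P)=E\|\hat\theta^{\rm R}(P)-\theta_0\|^2$ and $\mathscr F_{\rm Sg}(P)=\|\hat\theta^{\rm LS}-\hat\theta^{\rm R}(P)\|^2+\sigma^2{\rm Tr}\big(2R^{-1}-(\Phi^T\Phi)^{-1}\big)$ (SUREg); - ${\rm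 MSEy}(P)=E\sum_{t=1}^N\big(\phi(t)^T\theta_0+v^*(t)-\phi(t)^T\hat\theta^{\rm R}(P)\big)^2$, where $v^*$ is an independent copy of $v$, and $\mathscr F_{\rm Sy}(P)=\|Y-\Phi\hat\theta^{\rm R}(P)\|^2+2\sigma^2{\rm Tr}(\Phi P\Phi^TQ^{-1})$ (SUREy); - $\mathscr F_{\rm EB}(P)=Y^TQ^{-1}Y+\log\det Q$ (EB) and ${\rm EEB}(P)=E[\mathscr F_{\rm EB}(P)]$ (EEB). Here $E$ is the expectation over the noise for given $\Phi$. Let $\Omega\subset\mathbb R^p$ be compact and let $\eta\mapsto P(\eta)$ be twice continuously differentiable on an open set containing $\Omega$, with $P(\eta)$ positive definite for all $\eta\in\Omega$. Let $\hat\eta_{\rm MSEg},\hat\eta_{\rm Sg},\hat\eta_{\rm MSEy},\hat\eta_{\rm Sy},\hat\eta_{\rm EEB},\hat\eta_{\rm EB}$ be $\Omega$-valued and, whenever $\Phi^T\Phi$ is nonsingular, minimizers over $\eta\in\Omega$ of the corresponding criterion at $P(\eta)$; assume that each of them lies in the interior of $\Omega$ with probability tending to one as $N\to\infty$. For a positive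 definite $\Sigma\in\mathbb R^{n\times n}$ put $$W_g(P)=\sigma^4\theta_0^TP^{-T}\Sigma^{-2}P^{-1}\theta_0-2\sigma^4{\rm Tr}(\Sigma^{-1}P^{-1}\Sigma^{-1}),$$ $$W_y(P)=\sigma^4\theta_0^TP^{-T}\Sigma^{-1}P^{-1}\theta_0-2\sigma^4{\rm Tr}(\Sigma^{-1}P^{-1}),\qquad W_B(P)=\theta_0^TP^{-1}\theta_0+\log\det P,$$ and let $\eta_g^*,\eta_y^*,\eta_B^*\subset\Omega$ be the sets of minimizers over $\Omega$ of $W_g(P(\eta)),W_y(P(\eta)),W_B(P(\eta))$. Assume that these sets are discrete and that the Hessian with respect to $\eta$ of the corresponding function is positive definite at each of their points. Write $\|\eta-D\|=\inf_{\bar\eta\in D}\|\eta-\bar\eta\|$ for a set $D$, and $\xi_N=O_p(a_N)$ if for every $\varepsilon>0$ there is $L>0$ with $\mathbb P(|\xi_N|>L|a_N|)<\varepsilon$ for all $N\ge1$. **Theorem.** Suppose that $\|\Phi^T\Phi/N-\Sigma\|=O_p(\delta_N)$ in the Frobenius norm, where $\delta_N>0$ and $\delta_N\to0$ as $N\to\infty$.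 Put $\varpi_N=\max(\delta_N,1/N)$ and $\mu_N=\max(\delta_N,1/\sqrt N)$. Then $$\|\hat\eta_{\rm MSEg}-\eta_g^*\|=O_p(\varpi_N),\qquad \|\hat\eta_{\rm Sg}-\eta_g^*\|=O_p(\mu_N),$$ $$\|\hat\eta_{\rm MSEy}-\eta_y^*\|=O_p(\varpi_N),\qquad \|\hat\eta_{\rm Sy}-\eta_y^*\|=O_p(\mu_N),$$ $$\|\hat\eta_{\rm EEB}-\eta_B^*\|=O_p(1/N),\qquad \|\hat\eta_{\rm EB}-\eta_B^*\|=O_p(1/\sqrt N).$$ In particular the rates of EEB and EB do not depend on $\delta_N$. -/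

import Mathlib

open MeasureTheory ProbabilityTheory Filter Topology
open scoped Matrix ENNReal

noncomputable section

namespace FIR

/-- The space of hyperparameter vectors, with the Euclidean norm. -/
abbrev Hyper (p : ℕ) : Type := EuclideanSpace ℝ (Fin p)

/-! ### Vectors, matrices, stochastic order -/

/-- The squared Euclidean norm of a vector. -/
def sqNorm {ι : Type*} [Fintype ι] (x : ι → ℝ) : ℝ := ∑ i, x i ^ 2

/-- The Frobenius norm of a square matrix. -/
def frobNorm {n : ℕ} (A : Matrix (Fin n) (Fin n) ℝ) : ℝ := √(∑ i, ∑ j, A i j ^ 2)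

/-- `ξ_N = O_p(a_N)`: for every `ε > 0` there is `L > 0` such that
`μ (|ξ_N| > L |a_N|) < ε` for all sample sizes `N = 1, 2, …`. -/
def IsBigOp {S : Type*} [MeasurableSpace S] (μ : Measure S)
    (ξ : ℕ → S → ℝ) (a : ℕ → ℝ) : Prop :=
  ∀ ε : ℝ, 0 < ε → ∃ L : ℝ, 0 < L ∧
    ∀ N : ℕ, 1 ≤ N → μ {ω | L * |a N| < |ξ N ω|} < ENNReal.ofReal ε

/-- The set of global minimizers of `W` over `Θ`. -/
def argminOn {p : ℕ} (Θ : Set (Hyper p)) (W : Hyper p → ℝ) : Set (Hyper p) :=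
  {η | η ∈ Θ ∧ ∀ η' ∈ Θ, W η ≤ W η'}

/-! ### The data -/

/-- Zero-mean (second-order) white noise `v 1, v 2, …` with variance `σ ^ 2`. -/
def IsWhiteNoise {S : Type*} [MeasurableSpace S] (μ : Measure S)
    (v : ℕ → S → ℝ) (σ : ℝ) : Prop :=
  (∀ t, 1 ≤ t → MemLp (v t) 2 μ) ∧
  (∀ t, 1 ≤ t → ∫ ω, v t ω ∂μ = 0) ∧
  (∀ t, 1 ≤ t → ∫ ω, v t ω ^ 2 ∂μ = σ ^ 2) ∧
  (∀ s t, 1 ≤ s → 1 ≤ t → s ≠ t → ∫ ω, v s ω * v t ω ∂μ = 0)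

/-- The regression matrix `Φ` with rows `φ(t)ᵀ = [u(t-1), …, u(t-n)]`, `t = 1, …, N`.
Row `i : Fin N` is time `t = i + 1` and column `j : Fin n` is lag `j + 1`. -/
def regMatrix {S : Type*} (n : ℕ) (u : ℤ → S → ℝ) (N : ℕ) (ω : S) :
    Matrix (Fin N) (Fin n) ℝ :=
  Matrix.of fun i j => u (((i : ℕ) + 1 : ℤ) - ((j : ℕ) + 1 : ℤ)) ω

/-- The noise vector `V = [v(1), …, v(N)]ᵀ`. -/
def noiseVec {S : Type*} (v : ℕ → S → ℝ) (N : ℕ) (ω : S) : Fin N → ℝ :=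
  fun i => v ((i : ℕ) + 1) ω

/-- The output vector `Y = Φ θ₀ + V`. -/
def outputVec {S : Type*} {n : ℕ} (u : ℤ → S → ℝ) (v : ℕ → S → ℝ) (θ₀ : Fin n → ℝ)
    (N : ℕ) (ω : S) : Fin N → ℝ :=
  regMatrix n u N ω *ᵥ θ₀ + noiseVec v N ω

/-! ### Estimators of the impulse response, for a given kernel matrix `P` -/

/-- `Q = Φ P Φᵀ + σ² I_N`. -/
def Qmat {n N : ℕ} (σ : ℝ) (Φ : Matrix (Fin N) (Fin n) ℝ) (P : Matrix (Fin n) (Fin n) ℝ) :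
    Matrix (Fin N) (Fin N) ℝ :=
  Φ * P * Φᵀ + σ ^ 2 • (1 : Matrix (Fin N) (Fin N) ℝ)

/-- `R = Φᵀ Φ + σ² P⁻¹`. -/
def Rmat {n N : ℕ} (σ : ℝ) (Φ : Matrix (Fin N) (Fin n) ℝ) (P : Matrix (Fin n) (Fin n) ℝ) :
    Matrix (Fin n) (Fin n) ℝ :=
  Φᵀ * Φ + σ ^ 2 • P⁻¹

/-- The least squares estimator `(Φᵀ Φ)⁻¹ Φᵀ Y`. -/
def lsEst {n N : ℕ} (Φ : Matrix (Fin N) (Fin n) ℝ) (Y : Fin N → ℝ) : Fin n → ℝ :=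
  ((Φᵀ * Φ)⁻¹ * Φᵀ) *ᵥ Y

/-- The regularized least squares estimator `P Φᵀ Q⁻¹ Y`. -/
def rlsEst {n N : ℕ} (σ : ℝ) (Φ : Matrix (Fin N) (Fin n) ℝ) (P : Matrix (Fin n) (Fin n) ℝ)
    (Y : Fin N → ℝ) : Fin n → ℝ :=
  (P * Φᵀ * (Qmat σ Φ P)⁻¹) *ᵥ Y

/-! ### The six criteria, as functions of the kernel matrix `P` -/

/-- SUREg: `‖θ_LS - θ_R‖² + σ² Tr(2 R⁻¹ - (Φᵀ Φ)⁻¹)`. -/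
def sureG {n N : ℕ} (σ : ℝ) (Φ : Matrix (Fin N) (Fin n) ℝ) (Y : Fin N → ℝ)
    (P : Matrix (Fin n) (Fin n) ℝ) : ℝ :=
  sqNorm (lsEst Φ Y - rlsEst σ Φ P Y)
    + σ ^ 2 * ((2 : ℝ) • (Rmat σ Φ P)⁻¹ - (Φᵀ * Φ)⁻¹).trace

/-- SUREy: `‖Y - Φ θ_R‖² + 2 σ² Tr(Φ P Φᵀ Q⁻¹)`. -/
def sureY {n N : ℕ} (σ : ℝ) (Φ : Matrix (Fin N) (Fin n) ℝ) (Y : Fin N → ℝ)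
    (P : Matrix (Fin n) (Fin n) ℝ) : ℝ :=
  sqNorm (Y - Φ *ᵥ rlsEst σ Φ P Y)
    + 2 * σ ^ 2 * (Φ * P * Φᵀ * (Qmat σ Φ P)⁻¹).trace

/-- EB: `Yᵀ Q⁻¹ Y + log det Q`. -/
def critEB {n N : ℕ} (σ : ℝ) (Φ : Matrix (Fin N) (Fin n) ℝ) (Y : Fin N → ℝ)
    (P : Matrix (Fin n) (Fin n) ℝ) : ℝ :=
  Y ⬝ᵥ ((Qmat σ Φ P)⁻¹ *ᵥ Y) + Real.log (Qmat σ Φ P).det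

/-- MSEg: `E ‖θ_R - θ₀‖²`, the expectation being over the noise vector `V`, for a given `Φ`. -/
def mseG {S : Type*} [MeasurableSpace S] (μ : Measure S) {n N : ℕ} (σ : ℝ) (θ₀ : Fin n → ℝ)
    (V : S → Fin N → ℝ) (Φ : Matrix (Fin N) (Fin n) ℝ) (P : Matrix (Fin n) (Fin n) ℝ) : ℝ :=
  ∫ ω, sqNorm (rlsEst σ Φ P (Φ *ᵥ θ₀ + V ω) - θ₀) ∂μ

/-- MSEy: `E ∑_t (φ(t)ᵀ θ₀ + v*(t) - φ(t)ᵀ θ_R)²`, the expectation being over the noise vector `V`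
and its independent copy `V*`, for a given `Φ`. -/
def mseY {S : Type*} [MeasurableSpace S] (μ : Measure S) {n N : ℕ} (σ : ℝ) (θ₀ : Fin n → ℝ)
    (V : S → Fin N → ℝ) (Φ : Matrix (Fin N) (Fin n) ℝ) (P : Matrix (Fin n) (Fin n) ℝ) : ℝ :=
  ∫ z, sqNorm (Φ *ᵥ θ₀ + V z.2 - Φ *ᵥ rlsEst σ Φ P (Φ *ᵥ θ₀ + V z.1)) ∂(μ.prod μ)

/-- EEB: the expectation of the EB criterion over the noise vector `V`, for a given `Φ`. -/
def critEEB {S : Type*} [MeasurableSpace S] (μ : Measure S) {n N : ℕ} (σ : ℝ) (θ₀ : Fin n → ℝ)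
    (V : S → Fin N → ℝ) (Φ : Matrix (Fin N) (Fin n) ℝ) (P : Matrix (Fin n) (Fin n) ℝ) : ℝ :=
  ∫ ω, critEB σ Φ (Φ *ᵥ θ₀ + V ω) P ∂μ

/-! ### The limit criteria -/

/-- `W_g = σ⁴ θ₀ᵀ P⁻ᵀ Σ⁻² P⁻¹ θ₀ - 2 σ⁴ Tr(Σ⁻¹ P⁻¹ Σ⁻¹)`. -/
def limG {n : ℕ} (σ : ℝ) (Sig : Matrix (Fin n) (Fin n) ℝ) (θ₀ : Fin n → ℝ)
    (P : Matrix (Fin n) (Fin n) ℝ) : ℝ :=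
  σ ^ 4 * (θ₀ ⬝ᵥ ((P⁻¹ᵀ * (Sig⁻¹ * Sig⁻¹) * P⁻¹) *ᵥ θ₀))
    - 2 * σ ^ 4 * (Sig⁻¹ * P⁻¹ * Sig⁻¹).trace

/-- `W_y = σ⁴ θ₀ᵀ P⁻ᵀ Σ⁻¹ P⁻¹ θ₀ - 2 σ⁴ Tr(Σ⁻¹ P⁻¹)`. -/
def limY {n : ℕ} (σ : ℝ) (Sig : Matrix (Fin n) (Fin n) ℝ) (θ₀ : Fin n → ℝ)
    (P : Matrix (Fin n) (Fin n) ℝ) : ℝ :=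
  σ ^ 4 * (θ₀ ⬝ᵥ ((P⁻¹ᵀ * Sig⁻¹ * P⁻¹) *ᵥ θ₀)) - 2 * σ ^ 4 * (Sig⁻¹ * P⁻¹).trace

/-- `W_B = θ₀ᵀ P⁻¹ θ₀ + log det P`. -/
def limB {n : ℕ} (θ₀ : Fin n → ℝ) (P : Matrix (Fin n) (Fin n) ℝ) : ℝ :=
  θ₀ ⬝ᵥ (P⁻¹ *ᵥ θ₀) + Real.log P.det

/-! ### Hyperparameter estimators and the assumptions on them -/

/-- `η N` is, almost surely, a point of `Θ`, and it minimizes the criterion `J N` over `Θ` as soon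
as `Φᵀ Φ` is nonsingular (which the SUREg criterion needs in order to be defined). -/
def IsEstimator {S : Type*} [MeasurableSpace S] (μ : Measure S) (n : ℕ) (u : ℤ → S → ℝ) {p : ℕ}
    (Θ : Set (Hyper p)) (J : ℕ → S → Hyper p → ℝ) (η : ℕ → S → Hyper p) : Prop :=
  ∀ N, 1 ≤ N → ∀ᵐ ω ∂μ, η N ω ∈ Θ ∧
    (((regMatrix n u N ω)ᵀ * regMatrix n u N ω).det ≠ 0 → η N ω ∈ argminOn Θ (J N ω))

/-- With probability tending to one, the estimate is an interior point of `Θ`. -/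
def AsympInterior {S : Type*} [MeasurableSpace S] (μ : Measure S) {p : ℕ}
    (Θ : Set (Hyper p)) (η : ℕ → S → Hyper p) : Prop :=
  Tendsto (fun N => μ {ω | η N ω ∉ interior Θ}) atTop (𝓝 0)

/-- The minimizers of `W` over `Θ` are isolated and nondegenerate: the set of minimizers is
discrete, and the Hessian of `W` is positive definite at each of them. -/
def NondegMinimizers {p : ℕ} (Θ : Set (Hyper p)) (W : Hyper p → ℝ) : Prop :=
  DiscreteTopology (argminOn Θ W) ∧
  ∀ η ∈ argminOn Θ W, ∀ x : Hyper p, x ≠ 0 → 0 < fderiv ℝ (fderiv ℝ W) η x x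

end FIR

end

/-! After multiplication by a positive factor and subtraction of terms free of `η`, each criterion
is a fixed function `F (x, η)` of the statistics `x = (ΦᵀΦ/N, 1/N, ΦᵀV/N)`. Woodbury-type identities
produce this form. `F` is twice continuously differentiable near `x = (Σ, 0, 0)`, where it equals
the limit criterion `W` up to a constant. In the three expected criteria the noise averages out, so
their third statistic is zero and `x` is within order `max(δ, 1/N)` of `(Σ, 0, 0)`. For the other
three, Chebyshev's inequality makes `ΦᵀV/N` of order `1/√N`.

The deterministic core is `exists_infDist_argminOn_le`. Suppose `F (x', ·)` is `W` up to a constant.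
Mixed second differences of `F` are at most `C ‖x - x'‖ ‖ζ - η‖`, so a minimizer `η` of `F (x, ·)`
satisfies `W ζ - W η ≥ -C ‖x - x'‖ ‖ζ - η‖` on `Θ`. By compactness this forces `η` close to the
minimizers of `W`. At an interior point it also bounds the gradient of `W` at `η` by `C ‖x - x'‖`,
and nondegeneracy of the Hessian turns that into a bound on the distance. `isBigOp_infDist_argminOn`
transfers the bound to stochastic orders.

For EB and EEB the value of `F` at `(A, 0, 0)` is `W_B + log det A` for every `A`. Comparing with
`x' = (ΦᵀΦ/N, 0, 0)` instead of `(Σ, 0, 0)` removes the error of the Gram matrix altogether, which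
is why `δ` is absent from these rates. -/

noncomputable section

namespace FIR

/-! ### Perturbation of nondegenerate minimizers -/

section Perturbation

variable {X E : Type*} [NormedAddCommGroup X] [NormedSpace ℝ X]
  [NormedAddCommGroup E] [NormedSpace ℝ E]

/-- Near a point where `F` is twice continuously differentiable, its mixed second differences are
bounded by the product of the increments. -/
theorem exists_mixed_diff_le_nhds {F : X × E → ℝ} {x₀ : X} {η₀ : E}
    (hF : ContDiffAt ℝ 2 F (x₀, η₀)) :
    ∃ r > 0, ∃ C, 0 ≤ C ∧ ∀ x ∈ Metric.ball x₀ r, ∀ x' ∈ Metric.ball x₀ r,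
      ∀ η ∈ Metric.ball η₀ r, ∀ η' ∈ Metric.ball η₀ r,
        |F (x, η) - F (x', η) - (F (x, η') - F (x', η'))| ≤ C * ‖x - x'‖ * ‖η - η'‖ := by
  have h1 : ContDiffAt ℝ 1 (fderiv ℝ F) (x₀, η₀) := hF.fderiv_right (by norm_num)
  obtain ⟨K, t, ht, hK⟩ := h1.exists_lipschitzOnWith
  have hd : ∀ᶠ z in 𝓝 (x₀, η₀), DifferentiableAt ℝ F z := by
    filter_upwards [hF.eventually (by simp)] with z hz
    exact hz.differentiableAt (by norm_num)
  obtain ⟨r, hr, hball⟩ := Metric.eventually_nhds_iff_ball.1 (hd.and ht)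
  have hsub : ∀ x ∈ Metric.ball x₀ r, ∀ η ∈ Metric.ball η₀ r,
      DifferentiableAt ℝ F (x, η) ∧ (x, η) ∈ t := by
    intro x hx η hη
    refine hball (x, η) ?_
    rw [← ball_prod_same]
    exact ⟨hx, hη⟩
  refine ⟨r, hr, K, K.2, fun x hx x' hx' η hη η' hη' => ?_⟩
  -- Mean value inequality in `ζ` for `F (x, ζ) - F (x', ζ)`: its derivative is a difference of
  -- values of `fderiv ℝ F`, which is Lipschitz near the base point.
  have key := Convex.norm_image_sub_le_of_norm_hasFDerivWithin_le
    (f := fun ζ => F (x, ζ) - F (x', ζ))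
    (f' := fun ζ => (fderiv ℝ F (x, ζ)).comp (ContinuousLinearMap.inr ℝ X E)
      - (fderiv ℝ F (x', ζ)).comp (ContinuousLinearMap.inr ℝ X E))
    (C := K * ‖x - x'‖) (s := Metric.ball η₀ r) (𝕜 := ℝ)
    (fun ζ hζ => by
      have e1 := (hsub x hx ζ hζ).1.hasFDerivAt.comp ζ (hasFDerivAt_prodMk_right x ζ)
      have e2 := (hsub x' hx' ζ hζ).1.hasFDerivAt.comp ζ (hasFDerivAt_prodMk_right x' ζ)
      exact (e1.sub e2).hasFDerivWithinAt)
    (fun ζ hζ => by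
      rw [← ContinuousLinearMap.sub_comp]
      refine (ContinuousLinearMap.opNorm_comp_le _ _).trans ?_
      have e3 := hK.dist_le_mul _ (hsub x hx ζ hζ).2 _ (hsub x' hx' ζ hζ).2
      rw [dist_eq_norm, dist_eq_norm] at e3
      have e4 : ‖((x, ζ) : X × E) - (x', ζ)‖ = ‖x - x'‖ := by
        simp [Prod.norm_def]
      rw [e4] at e3
      have e5 := ContinuousLinearMap.norm_inr_le_one ℝ X E
      calc _ ≤ (K * ‖x - x'‖) * 1 := by gcongr
        _ = _ := mul_one _)
    (convex_ball η₀ r) hη' hη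
  simpa [Real.norm_eq_abs] using key

/-- Serves the pairs `η ≠ η'` off the diagonal, where no smallness in `η - η'` has to be gained. -/
theorem exists_diff_le_nhds {F : X × E → ℝ} {x₀ : X} {η₀ : E}
    (hF : ContDiffAt ℝ 2 F (x₀, η₀)) :
    ∃ r > 0, ∃ C, 0 ≤ C ∧ ∀ x ∈ Metric.ball x₀ r, ∀ x' ∈ Metric.ball x₀ r,
      ∀ η ∈ Metric.ball η₀ r, |F (x, η) - F (x', η)| ≤ C * ‖x - x'‖ := by
  obtain ⟨K, t, ht, hK⟩ := (hF.of_le (by norm_num : (1 : WithTop ℕ∞) ≤ 2)).exists_lipschitzOnWith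
  obtain ⟨r, hr, hball⟩ := Metric.mem_nhds_iff.1 ht
  refine ⟨r, hr, K, K.2, fun x hx x' hx' η hη => ?_⟩
  have e3 := hK.dist_le_mul (x, η) (hball (by rw [← ball_prod_same]; exact ⟨hx, hη⟩))
    (x', η) (hball (by rw [← ball_prod_same]; exact ⟨hx', hη⟩))
  rw [dist_eq_norm, dist_eq_norm] at e3
  have e4 : ‖((x, η) : X × E) - (x', η)‖ = ‖x - x'‖ := by simp [Prod.norm_def]
  rwa [e4] at e3

/-- The bound on mixed second differences is uniform over a compact set of second arguments. -/
theorem exists_mixed_diff_le {F : X × E → ℝ} {x₀ : X} {Θ : Set E} (hΘ : IsCompact Θ)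
    (hF : ∀ η ∈ Θ, ContDiffAt ℝ 2 F (x₀, η)) :
    ∃ r > 0, ∃ C, 0 ≤ C ∧ ∀ x ∈ Metric.ball x₀ r, ∀ x' ∈ Metric.ball x₀ r,
      ∀ η ∈ Θ, ∀ η' ∈ Θ,
        |F (x, η) - F (x', η) - (F (x, η') - F (x', η'))| ≤ C * ‖x - x'‖ * ‖η - η'‖ := by
  -- Stated over pairs so that compactness of `Θ ×ˢ Θ` glues the local bounds; no convexity of `Θ`
  -- is available for a direct mean value argument.
  have main : ∃ r > 0, ∃ C, 0 ≤ C ∧ ∀ x ∈ Metric.ball x₀ r, ∀ x' ∈ Metric.ball x₀ r,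
      ∀ q ∈ Θ ×ˢ Θ, |F (x, q.1) - F (x', q.1) - (F (x, q.2) - F (x', q.2))|
        ≤ C * ‖x - x'‖ * ‖q.1 - q.2‖ := by
    refine (hΘ.prod hΘ).induction_on (p := fun s => ∃ r > 0, ∃ C, 0 ≤ C ∧
      ∀ x ∈ Metric.ball x₀ r, ∀ x' ∈ Metric.ball x₀ r,
      ∀ q ∈ s, |F (x, q.1) - F (x', q.1) - (F (x, q.2) - F (x', q.2))|
        ≤ C * ‖x - x'‖ * ‖q.1 - q.2‖) ?_ ?_ ?_ ?_
    · exact ⟨1, one_pos, 0, le_rfl, by simp⟩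
    · rintro s t hst ⟨r, hr, C, hC, h⟩
      exact ⟨r, hr, C, hC, fun x hx x' hx' q hq => h x hx x' hx' q (hst hq)⟩
    · rintro s t ⟨r, hr, C, hC, h⟩ ⟨r', hr', C', hC', h'⟩
      refine ⟨min r r', lt_min hr hr', max C C', le_max_of_le_left hC, ?_⟩
      rintro x hx x' hx' q (hq | hq)
      · refine (h x (Metric.ball_subset_ball (min_le_left _ _) hx)
          x' (Metric.ball_subset_ball (min_le_left _ _) hx') q hq).trans ?_
        gcongr
        exact le_max_left _ _
      · refine (h' x (Metric.ball_subset_ball (min_le_right _ _) hx)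
          x' (Metric.ball_subset_ball (min_le_right _ _) hx') q hq).trans ?_
        gcongr
        exact le_max_right _ _
    · rintro ⟨η₁, η₂⟩ ⟨h₁, h₂⟩
      by_cases hne : η₁ = η₂
      · subst hne
        obtain ⟨r, hr, C, hC, h⟩ := exists_mixed_diff_le_nhds (hF η₁ h₁)
        refine ⟨Metric.ball η₁ r ×ˢ Metric.ball η₁ r, mem_nhdsWithin_of_mem_nhds
          (prod_mem_nhds (Metric.ball_mem_nhds _ hr) (Metric.ball_mem_nhds _ hr)),
          r, hr, C, hC, ?_⟩
        rintro x hx x' hx' q ⟨hq1, hq2⟩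
        exact h x hx x' hx' _ hq1 _ hq2
      -- Off the diagonal `‖q.1 - q.2‖` is bounded below, so the factor can be absorbed into the
      -- constant.
      · have hd : 0 < dist η₁ η₂ := dist_pos.2 hne
        obtain ⟨r, hr, C, hC, h⟩ := exists_diff_le_nhds (hF η₁ h₁)
        obtain ⟨r', hr', C', hC', h'⟩ := exists_diff_le_nhds (hF η₂ h₂)
        have hmem : {q : E × E | dist η₁ η₂ / 2 < dist q.1 q.2} ∈ 𝓝 (η₁, η₂) := by
          refine (isOpen_lt continuous_const (by fun_prop)).mem_nhds ?_
          change dist η₁ η₂ / 2 < dist η₁ η₂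
          linarith
        refine ⟨Metric.ball η₁ r ×ˢ Metric.ball η₂ r' ∩ {q | dist η₁ η₂ / 2 < dist q.1 q.2},
          mem_nhdsWithin_of_mem_nhds (inter_mem (prod_mem_nhds (Metric.ball_mem_nhds _ hr)
            (Metric.ball_mem_nhds _ hr')) hmem), min r r', lt_min hr hr',
          (C + C') / (dist η₁ η₂ / 2), by positivity, ?_⟩
        rintro x hx x' hx' q ⟨⟨hq1, hq2⟩, hq⟩
        have a1 := h x (Metric.ball_subset_ball (min_le_left _ _) hx)
          x' (Metric.ball_subset_ball (min_le_left _ _) hx') _ hq1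
        have a2 := h' x (Metric.ball_subset_ball (min_le_right _ _) hx)
          x' (Metric.ball_subset_ball (min_le_right _ _) hx') _ hq2
        have hq' : dist η₁ η₂ / 2 ≤ ‖q.1 - q.2‖ := by
          rw [← dist_eq_norm]; exact le_of_lt hq
        calc _ ≤ |F (x, q.1) - F (x', q.1)| + |F (x, q.2) - F (x', q.2)| := abs_sub _ _
          _ ≤ (C + C') * ‖x - x'‖ := by linarith
          _ = (C + C') / (dist η₁ η₂ / 2) * ‖x - x'‖ * (dist η₁ η₂ / 2) := by
            field_simp
          _ ≤ _ := by gcongr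
  obtain ⟨r, hr, C, hC, h⟩ := main
  exact ⟨r, hr, C, hC, fun x hx x' hx' η hη η' hη' => h x hx x' hx' (η, η') ⟨hη, hη'⟩⟩

/-- An approximate form of Fermat's rule: the one-sided bound is used in the directions `k` and
`-k`, and linearity makes it two-sided. -/
theorem norm_fderiv_le_of_eventually_sub_ge {f : E → ℝ} {a : E} {ρ : ℝ} (hρ : 0 ≤ ρ)
    (hf : DifferentiableAt ℝ f a) (h : ∀ᶠ η in 𝓝 a, -(ρ * ‖η - a‖) ≤ f η - f a) :
    ‖fderiv ℝ f a‖ ≤ ρ := by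
  refine le_of_forall_pos_le_add fun ε hε => ?_
  have hlo := hf.hasFDerivAt.isLittleO.def hε
  have hone : ∀ᶠ η in 𝓝 a, -((ρ + ε) * ‖η - a‖) ≤ fderiv ℝ f a (η - a) := by
    filter_upwards [h, hlo] with η h1 h2
    rw [Real.norm_eq_abs] at h2
    have := (abs_le.1 h2).2
    linarith
  have h0 : ∀ᶠ k in 𝓝 (0 : E), -((ρ + ε) * ‖k‖) ≤ fderiv ℝ f a k := by
    have ht : Tendsto (fun k : E => a + k) (𝓝 0) (𝓝 a) := by
      have : Continuous fun k : E => a + k := by fun_prop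
      simpa using this.tendsto 0
    filter_upwards [ht.eventually hone] with k hk
    simpa using hk
  have h0' : ∀ᶠ k in 𝓝 (0 : E), -((ρ + ε) * ‖-k‖) ≤ fderiv ℝ f a (-k) := by
    have ht : Tendsto (fun k : E => -k) (𝓝 0) (𝓝 0) := by
      simpa using (continuous_neg (G := E)).tendsto 0
    exact ht.eventually h0
  refine ContinuousLinearMap.opNorm_le_of_nhds_zero (by positivity) ?_
  filter_upwards [h0, h0'] with k h1 h2
  rw [map_neg, norm_neg] at h2
  rw [Real.norm_eq_abs, abs_le]
  constructor <;> linarith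

/-- Near a point where the Hessian is positive definite, the gradient grows at least linearly with
the distance to that point, whether or not the point is critical. -/
theorem exists_dist_le_norm_fderiv [FiniteDimensional ℝ E] {W : E → ℝ} {a : E}
    (hW : ContDiffAt ℝ 2 W a)
    (hH : ∀ x : E, x ≠ 0 → 0 < fderiv ℝ (fderiv ℝ W) a x x) :
    ∃ C, 0 ≤ C ∧ ∀ᶠ η in 𝓝 a, dist η a ≤ C * ‖fderiv ℝ W η‖ := by
  have h1 : ContDiffAt ℝ 1 (fderiv ℝ W) a := hW.fderiv_right (by norm_num)
  -- A minimizer on the boundary of `Θ` need not be critical. If it is not, the gradient stays away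
  -- from zero nearby and the bound is trivial.
  by_cases h0 : fderiv ℝ W a = 0
  · set H := fderiv ℝ (fderiv ℝ W) a with hHdef
    -- Positive definiteness enters only through injectivity of the Hessian, which in finite
    -- dimension gives a quantitative lower bound.
    have hinj : LinearMap.ker (H : E →ₗ[ℝ] (E →L[ℝ] ℝ)) = ⊥ := by
      rw [LinearMap.ker_eq_bot']
      intro x hx
      by_contra hne
      have := hH x hne
      have hx' : H x = 0 := hx
      rw [hx'] at this
      simp at this
    obtain ⟨K, hK, hanti⟩ := LinearMap.exists_antilipschitzWith (H : E →ₗ[ℝ] (E →L[ℝ] ℝ)) hinj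
    have hbound : ∀ x, ‖x‖ ≤ K * ‖H x‖ := fun x => by
      have := hanti.le_mul_dist x 0
      simpa using this
    have hK' : (0 : ℝ) < K := hK
    have hd : HasFDerivAt (fderiv ℝ W) H a := (h1.differentiableAt (by norm_num)).hasFDerivAt
    refine ⟨2 * K, by positivity, ?_⟩
    filter_upwards [hd.isLittleO.def (c := 1 / (2 * K)) (by positivity)] with η hη
    rw [h0, sub_zero] at hη
    have b1 := hbound (η - a)
    have b2 : ‖H (η - a)‖ ≤ ‖fderiv ℝ W η‖ + ‖fderiv ℝ W η - H (η - a)‖ := by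
      have := norm_sub_le (fderiv ℝ W η) (fderiv ℝ W η - H (η - a))
      simpa using this
    have b3 : (K : ℝ) * ‖fderiv ℝ W η - H (η - a)‖ ≤ ‖η - a‖ / 2 := by
      calc (K : ℝ) * ‖fderiv ℝ W η - H (η - a)‖ ≤ K * (1 / (2 * K) * ‖η - a‖) := by gcongr
        _ = ‖η - a‖ / 2 := by field_simp
    rw [dist_eq_norm]
    nlinarith [mul_le_mul_of_nonneg_left b2 hK'.le]
  · have hpos : 0 < ‖fderiv ℝ W a‖ := norm_pos_iff.2 h0
    have hc : ∀ᶠ η in 𝓝 a, ‖fderiv ℝ W a‖ / 2 < ‖fderiv ℝ W η‖ :=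
      h1.continuousAt.norm.eventually (lt_mem_nhds (by linarith))
    refine ⟨2 / ‖fderiv ℝ W a‖, by positivity, ?_⟩
    filter_upwards [hc, Metric.ball_mem_nhds a one_pos] with η h2 h3
    calc dist η a ≤ 1 := (Metric.mem_ball.1 h3).le
      _ = 2 / ‖fderiv ℝ W a‖ * (‖fderiv ℝ W a‖ / 2) := by field_simp
      _ ≤ _ := by gcongr

end Perturbation

/-! ### Minimizers over a compact set and their stability -/

variable {p : ℕ}

theorem isCompact_argminOn {Θ : Set (Hyper p)} (hΘ : IsCompact Θ) {W : Hyper p → ℝ}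
    (hW : ContinuousOn W Θ) : IsCompact (argminOn Θ W) := by
  rcases (argminOn Θ W).eq_empty_or_nonempty with h | ⟨a, ha⟩
  · rw [h]; exact isCompact_empty
  · have : argminOn Θ W = Θ ∩ W ⁻¹' Set.Iic (W a) := by
      ext η
      constructor
      · exact fun h => ⟨h.1, h.2 a ha.1⟩
      · exact fun h => ⟨h.1, fun η' hη' => (Set.mem_Iic.1 h.2).trans (ha.2 η' hη')⟩
    rw [this]
    exact hΘ.of_isClosed_subset (hW.preimage_isClosed_of_isClosed hΘ.isClosed isClosed_Iic)
      Set.inter_subset_left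

theorem argminOn_nonempty {Θ : Set (Hyper p)} (hΘ : IsCompact Θ) (hne : Θ.Nonempty)
    {W : Hyper p → ℝ} (hW : ContinuousOn W Θ) : (argminOn Θ W).Nonempty := by
  obtain ⟨a, ha, h⟩ := hΘ.exists_isMinOn hne hW
  exact ⟨a, ha, fun η hη => h hη⟩

/-- The distance to the set of minimizers is controlled by the gradient near that set. -/
theorem exists_infDist_le_norm_fderiv {Θ : Set (Hyper p)} (hΘ : IsCompact Θ) {W : Hyper p → ℝ}
    (hW : ∀ η ∈ Θ, ContDiffAt ℝ 2 W η) (hN : NondegMinimizers Θ W) :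
    ∃ C, 0 ≤ C ∧ ∃ V, IsOpen V ∧ argminOn Θ W ⊆ V ∧
      ∀ η ∈ V, Metric.infDist η (argminOn Θ W) ≤ C * ‖fderiv ℝ W η‖ := by
  have hcont : ContinuousOn W Θ := fun η hη => (hW η hη).continuousAt.continuousWithinAt
  refine (isCompact_argminOn hΘ hcont).induction_on (p := fun s => ∃ C, 0 ≤ C ∧ ∃ V, IsOpen V ∧
    s ⊆ V ∧ ∀ η ∈ V, Metric.infDist η (argminOn Θ W) ≤ C * ‖fderiv ℝ W η‖) ?_ ?_ ?_ ?_
  · exact ⟨0, le_rfl, ∅, isOpen_empty, le_rfl, by simp⟩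
  · rintro s t hst ⟨C, hC, V, hV, hs, h⟩
    exact ⟨C, hC, V, hV, hst.trans hs, h⟩
  · rintro s t ⟨C, hC, V, hV, hs, h⟩ ⟨C', hC', V', hV', hs', h'⟩
    refine ⟨max C C', le_max_of_le_left hC, V ∪ V', hV.union hV',
      Set.union_subset_union hs hs', ?_⟩
    rintro η (hη | hη)
    · refine (h η hη).trans ?_
      gcongr
      exact le_max_left _ _
    · refine (h' η hη).trans ?_
      gcongr
      exact le_max_right _ _
  · intro a ha
    obtain ⟨C, hC, h⟩ := exists_dist_le_norm_fderiv (hW a ha.1) (hN.2 a ha)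
    obtain ⟨V, hV, hVo, haV⟩ := eventually_nhds_iff.1 h
    exact ⟨V, mem_nhdsWithin_of_mem_nhds (hVo.mem_nhds haV), C, hC, V, hVo, le_rfl,
      fun η hη => (Metric.infDist_le_dist_of_mem ha).trans (hV η hη)⟩

/-- Interior minimizers of a smooth perturbation of `W` lie within a multiple of the size of the
perturbation from the nondegenerate minimizers of `W`. -/
theorem exists_infDist_argminOn_le {X : Type*} [NormedAddCommGroup X] [NormedSpace ℝ X]
    {Θ : Set (Hyper p)} (hΘ : IsCompact Θ) {W : Hyper p → ℝ}
    (hW : ∀ η ∈ Θ, ContDiffAt ℝ 2 W η) (hN : NondegMinimizers Θ W)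
    {F : X × Hyper p → ℝ} {x₀ : X} (hF : ∀ η ∈ Θ, ContDiffAt ℝ 2 F (x₀, η)) :
    ∃ r > 0, ∃ C, 0 ≤ C ∧ ∀ x ∈ Metric.ball x₀ r, ∀ x' ∈ Metric.ball x₀ r, ∀ c : ℝ,
      (∀ η ∈ Θ, F (x', η) = W η + c) →
      ∀ η ∈ argminOn Θ fun η => F (x, η), η ∈ interior Θ →
        Metric.infDist η (argminOn Θ W) ≤ C * ‖x - x'‖ := by
  rcases Θ.eq_empty_or_nonempty with hemp | hne
  · subst hemp
    exact ⟨1, one_pos, 0, le_rfl, fun x _ x' _ c _ η hη => absurd hη.1 (Set.notMem_empty η)⟩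
  have hcont : ContinuousOn W Θ := fun η hη => (hW η hη).continuousAt.continuousWithinAt
  obtain ⟨a, ha⟩ := argminOn_nonempty hΘ hne hcont
  obtain ⟨C₁, hC₁, V, hVo, hDV, hV⟩ := exists_infDist_le_norm_fderiv hΘ hW hN
  obtain ⟨r, hr, C, hC, hmix⟩ := exists_mixed_diff_le hΘ hF
  -- On the compact set `Θ \ V`, which contains no minimizer, `W` exceeds its minimum by a fixed
  -- gap.
  have hgap : ∃ κ > 0, ∀ η ∈ Θ, W η < W a + κ → η ∈ V := by
    rcases (Θ \ V).eq_empty_or_nonempty with h | h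
    · exact ⟨1, one_pos, fun η hη _ => by
        by_contra hηV
        exact Set.notMem_empty η (h ▸ ⟨hη, hηV⟩)⟩
    · obtain ⟨b, hb, hmin⟩ := (hΘ.diff hVo).exists_isMinOn h (hcont.mono Set.sdiff_subset)
      refine ⟨W b - W a, sub_pos.2 ?_, fun η hη hlt => ?_⟩
      · by_contra hle
        exact hb.2 (hDV ⟨hb.1, fun η' hη' => (not_lt.1 hle).trans (ha.2 η' hη')⟩)
      · by_contra hηV
        have : W b ≤ W η := hmin ⟨hη, hηV⟩
        linarith
  obtain ⟨κ, hκ, hκV⟩ := hgap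
  set d := Metric.diam Θ
  have hd : 0 ≤ d := Metric.diam_nonneg
  -- Two points of this ball satisfy `C * ‖x - x'‖ * d < κ`, so the perturbation cannot bridge the
  -- gap.
  refine ⟨min r (κ / (2 * (C * d + 1))), lt_min hr (by positivity), C₁ * C, by positivity, ?_⟩
  intro x hx x' hx' c hc η hη hint
  have hρ : ‖x - x'‖ < κ / (C * d + 1) := by
    rw [← dist_eq_norm]
    have e1 := (Metric.mem_ball.1 hx).trans_le (min_le_right _ _)
    have e2 := (Metric.mem_ball'.1 hx').trans_le (min_le_right _ _)
    have e3 : κ / (2 * (C * d + 1)) + κ / (2 * (C * d + 1)) = κ / (C * d + 1) := by field_simp; norm_num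
    linarith [dist_triangle x x₀ x']
  have hx1 := Metric.ball_subset_ball (min_le_left r (κ / (2 * (C * d + 1)))) hx
  have hx1' := Metric.ball_subset_ball (min_le_left r (κ / (2 * (C * d + 1)))) hx'
  -- Minimality of `η` for `F (x, ·)` is passed to `F (x', ·)` by the mixed difference bound; the
  -- constant `c` cancels.
  have hlow : ∀ ζ ∈ Θ, -(C * ‖x - x'‖ * ‖ζ - η‖) ≤ W ζ - W η := by
    intro ζ hζ
    have e1 := (abs_le.1 (hmix x hx1 x' hx1' ζ hζ η hη.1)).2
    have e2 := hη.2 ζ hζ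
    rw [hc ζ hζ, hc η hη.1] at e1
    simp only at e2
    linarith
  have hηV : η ∈ V := by
    refine hκV η hη.1 ?_
    have e1 := hlow a ha.1
    have e2 : ‖a - η‖ ≤ d := by
      rw [← dist_eq_norm]; exact Metric.dist_le_diam_of_mem hΘ.isBounded ha.1 hη.1
    have e3 : C * ‖x - x'‖ * ‖a - η‖ ≤ C * ‖x - x'‖ * d := by gcongr
    have e4 : ‖x - x'‖ * (C * d + 1) < κ := (lt_div_iff₀ (by positivity)).1 hρ
    nlinarith [norm_nonneg (x - x')]
  have hgrad : ‖fderiv ℝ W η‖ ≤ C * ‖x - x'‖ :=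
    norm_fderiv_le_of_eventually_sub_ge (by positivity)
      ((hW η hη.1).differentiableAt (by norm_num))
      (by filter_upwards [mem_interior_iff_mem_nhds.1 hint] with ζ hζ using hlow ζ hζ)
  calc _ ≤ C₁ * ‖fderiv ℝ W η‖ := hV η hηV
    _ ≤ C₁ * (C * ‖x - x'‖) := by gcongr
    _ = _ := by ring

/-! ### Smoothness of matrix expressions, with respect to the Frobenius norm -/

section Smooth

open scoped Matrix.Norms.Frobenius

variable {E : Type*} [NormedAddCommGroup E] [NormedSpace ℝ E] {n : ℕ} {k : WithTop ℕ∞} {a : E}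

/-- Links the hypothesis on the Gram matrix with the normed algebra structure used for smoothness.
-/
theorem frobNorm_eq_norm (A : Matrix (Fin n) (Fin n) ℝ) : frobNorm A = ‖A‖ := by
  rw [Matrix.frobenius_norm_def, frobNorm, Real.sqrt_eq_rpow]
  simp

theorem contDiffAt_linearMap_comp {F G : Type*} [NormedAddCommGroup F] [NormedSpace ℝ F]
    [FiniteDimensional ℝ F] [NormedAddCommGroup G] [NormedSpace ℝ G] (L : F →ₗ[ℝ] G)
    {f : E → F} (hf : ContDiffAt ℝ k f a) : ContDiffAt ℝ k (fun x => L (f x)) a :=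
  (LinearMap.toContinuousLinearMap L).contDiff.contDiffAt.comp a hf

theorem contDiffAt_matrix_apply {f : E → Matrix (Fin n) (Fin n) ℝ} (hf : ContDiffAt ℝ k f a)
    (i j : Fin n) : ContDiffAt ℝ k (fun x => f x i j) a :=
  contDiffAt_linearMap_comp (Matrix.entryLinearMap ℝ ℝ i j) hf

theorem contDiffAt_matrix {f : E → Matrix (Fin n) (Fin n) ℝ}
    (hf : ∀ i j, ContDiffAt ℝ k (fun x => f x i j) a) : ContDiffAt ℝ k f a := by
  have : f = fun x => ∑ i, ∑ j, f x i j • Matrix.single i j (1 : ℝ) := by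
    funext x
    conv_lhs => rw [Matrix.matrix_eq_sum_single (f x)]
    simp [Matrix.smul_single]
  rw [this]
  exact ContDiffAt.sum fun i _ => ContDiffAt.sum fun j _ => (hf i j).smul contDiffAt_const

theorem contDiffAt_matrix_mul {f g : E → Matrix (Fin n) (Fin n) ℝ} (hf : ContDiffAt ℝ k f a)
    (hg : ContDiffAt ℝ k g a) : ContDiffAt ℝ k (fun x => f x * g x) a :=
  hf.mul hg

theorem contDiffAt_matrix_transpose {f : E → Matrix (Fin n) (Fin n) ℝ}
    (hf : ContDiffAt ℝ k f a) : ContDiffAt ℝ k (fun x => (f x)ᵀ) a :=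
  contDiffAt_matrix fun i j => contDiffAt_matrix_apply hf j i

theorem contDiffAt_matrix_trace {f : E → Matrix (Fin n) (Fin n) ℝ} (hf : ContDiffAt ℝ k f a) :
    ContDiffAt ℝ k (fun x => (f x).trace) a :=
  contDiffAt_linearMap_comp (Matrix.traceLinearMap (Fin n) ℝ ℝ) hf

theorem contDiffAt_matrix_det {f : E → Matrix (Fin n) (Fin n) ℝ} (hf : ContDiffAt ℝ k f a) :
    ContDiffAt ℝ k (fun x => (f x).det) a := by
  simp only [Matrix.det_apply']
  exact ContDiffAt.sum fun τ _ => contDiffAt_const.mul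
    (contDiffAt_prod fun i _ => contDiffAt_matrix_apply hf _ _)

theorem contDiffAt_matrix_inv {f : E → Matrix (Fin n) (Fin n) ℝ} (hf : ContDiffAt ℝ k f a)
    (h : (f a).det ≠ 0) : ContDiffAt ℝ k (fun x => (f x)⁻¹) a := by
  simp only [Matrix.nonsing_inv_eq_ringInverse]
  have hu : IsUnit (f a) := (Matrix.isUnit_iff_isUnit_det _).2 h.isUnit
  obtain ⟨U, hU⟩ := hu
  have := contDiffAt_ringInverse ℝ (n := k) U
  rw [hU] at this
  exact this.comp a hf

theorem contDiffAt_dotProduct {f g : E → Fin n → ℝ} (hf : ContDiffAt ℝ k f a)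
    (hg : ContDiffAt ℝ k g a) : ContDiffAt ℝ k (fun x => f x ⬝ᵥ g x) a :=
  ContDiffAt.sum fun i _ => (contDiffAt_pi.1 hf i).mul (contDiffAt_pi.1 hg i)

theorem contDiffAt_mulVec {f : E → Matrix (Fin n) (Fin n) ℝ} {g : E → Fin n → ℝ}
    (hf : ContDiffAt ℝ k f a) (hg : ContDiffAt ℝ k g a) :
    ContDiffAt ℝ k (fun x => f x *ᵥ g x) a :=
  contDiffAt_pi.2 fun i => contDiffAt_dotProduct
    (contDiffAt_pi.2 fun j => contDiffAt_matrix_apply hf i j) hg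

end Smooth

/-! ### The criteria in reduced form

Up to scaling and additive constants, each criterion depends on the data only through the triple
`x = (Φᵀ Φ / N, 1 / N, Φᵀ V / N)`. -/

/-- The space of the triples `(Φᵀ Φ / N, 1 / N, Φᵀ V / N)`. -/
abbrev Stat (n : ℕ) : Type := Matrix (Fin n) (Fin n) ℝ × ℝ × (Fin n → ℝ)

variable {n : ℕ}

/-- `(R / N)⁻¹` as a function of the statistics and of `K = P⁻¹`. -/
def scaledInv (σ : ℝ) (x : Stat n) (K : Matrix (Fin n) (Fin n) ℝ) : Matrix (Fin n) (Fin n) ℝ :=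
  (x.1 + (x.2.1 * σ ^ 2) • K)⁻¹

/-- The least squares estimate as a function of the statistics. -/
def statLS (θ₀ : Fin n → ℝ) (x : Stat n) : Fin n → ℝ := θ₀ + x.1⁻¹ *ᵥ x.2.2

/-- This is `N²` times MSEg after removal of `σ² Tr (ΦᵀΦ)⁻¹`, the dominant term, which is free of
`η`. -/
def redMseG (σ : ℝ) (θ₀ : Fin n → ℝ) (x : Stat n) (P : Matrix (Fin n) (Fin n) ℝ) : ℝ :=
  σ ^ 4 * (θ₀ ⬝ᵥ ((P⁻¹ᵀ * (scaledInv σ x P⁻¹ * scaledInv σ x P⁻¹) * P⁻¹) *ᵥ θ₀))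
    - σ ^ 4 * (x.1⁻¹ * P⁻¹ * scaledInv σ x P⁻¹).trace
    - σ ^ 4 * (scaledInv σ x P⁻¹ * P⁻¹ * scaledInv σ x P⁻¹).trace

def redSureG (σ : ℝ) (θ₀ : Fin n → ℝ) (x : Stat n) (P : Matrix (Fin n) (Fin n) ℝ) : ℝ :=
  σ ^ 4 * (statLS θ₀ x ⬝ᵥ
      ((P⁻¹ᵀ * (scaledInv σ x P⁻¹ * scaledInv σ x P⁻¹) * P⁻¹) *ᵥ statLS θ₀ x))
    - 2 * σ ^ 4 * (x.1⁻¹ * P⁻¹ * scaledInv σ x P⁻¹).trace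

/-- Here the scaling factor is `N`, not `N²`: errors are weighted by `ΦᵀΦ`, which grows like `N`. -/
def redMseY (σ : ℝ) (θ₀ : Fin n → ℝ) (x : Stat n) (P : Matrix (Fin n) (Fin n) ℝ) : ℝ :=
  σ ^ 4 * (θ₀ ⬝ᵥ ((P⁻¹ᵀ * (scaledInv σ x P⁻¹ * x.1 * scaledInv σ x P⁻¹) * P⁻¹) *ᵥ θ₀))
    - 2 * σ ^ 4 * (scaledInv σ x P⁻¹ * P⁻¹).trace
    + x.2.1 * σ ^ 6 * (scaledInv σ x P⁻¹ * P⁻¹ * (scaledInv σ x P⁻¹ * P⁻¹)).trace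

def redSureY (σ : ℝ) (θ₀ : Fin n → ℝ) (x : Stat n) (P : Matrix (Fin n) (Fin n) ℝ) : ℝ :=
  σ ^ 4 * (statLS θ₀ x ⬝ᵥ
      ((P⁻¹ᵀ * (scaledInv σ x P⁻¹ * x.1 * scaledInv σ x P⁻¹) * P⁻¹) *ᵥ statLS θ₀ x))
    - 2 * σ ^ 4 * (scaledInv σ x P⁻¹ * P⁻¹).trace

/-- The part of the empirical Bayes criteria that is common to EB and EEB. -/
def redEBCore (σ : ℝ) (w : Fin n → ℝ) (x : Stat n) (P : Matrix (Fin n) (Fin n) ℝ) : ℝ :=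
  w ⬝ᵥ ((P⁻¹ - (x.2.1 * σ ^ 2) • (P⁻¹ * scaledInv σ x P⁻¹ * P⁻¹)) *ᵥ w)
    + Real.log P.det + Real.log (x.1 + (x.2.1 * σ ^ 2) • P⁻¹).det

def redEEB (σ : ℝ) (θ₀ : Fin n → ℝ) (x : Stat n) (P : Matrix (Fin n) (Fin n) ℝ) : ℝ :=
  redEBCore σ θ₀ x P + x.2.1 * σ ^ 2 * (scaledInv σ x P⁻¹ * P⁻¹).trace

def redEB (σ : ℝ) (θ₀ : Fin n → ℝ) (x : Stat n) (P : Matrix (Fin n) (Fin n) ℝ) : ℝ :=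
  redEBCore σ (statLS θ₀ x) x P

/-! ### Values of the reduced criteria at zero scale and zero noise -/

section ReducedLimits

variable (σ : ℝ) (θ₀ : Fin n → ℝ) (A P : Matrix (Fin n) (Fin n) ℝ)

theorem scaledInv_zero (K : Matrix (Fin n) (Fin n) ℝ) : scaledInv σ (A, 0, 0) K = A⁻¹ := by
  simp [scaledInv]

theorem statLS_zero (s : ℝ) : statLS θ₀ (A, s, 0) = θ₀ := by simp [statLS]

theorem redMseG_zero : redMseG σ θ₀ (A, 0, 0) P = limG σ A θ₀ P := by
  simp only [redMseG, limG, scaledInv_zero]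
  ring

theorem redSureG_zero : redSureG σ θ₀ (A, 0, 0) P = limG σ A θ₀ P := by
  simp only [redSureG, limG, scaledInv_zero, statLS_zero]

theorem redMseY_zero (hA : A.det ≠ 0) : redMseY σ θ₀ (A, 0, 0) P = limY σ A θ₀ P := by
  simp only [redMseY, limY, scaledInv_zero, Matrix.nonsing_inv_mul A hA.isUnit, one_mul]
  ring

theorem redSureY_zero (hA : A.det ≠ 0) : redSureY σ θ₀ (A, 0, 0) P = limY σ A θ₀ P := by
  simp only [redSureY, limY, scaledInv_zero, statLS_zero, Matrix.nonsing_inv_mul A hA.isUnit,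
    one_mul]

/-- The Gram matrix `A` enters only as an additive constant free of `P`; this is the source of the
`δ`-free rates of EB and EEB. -/
theorem redEBCore_zero : redEBCore σ θ₀ (A, 0, 0) P = limB θ₀ P + Real.log A.det := by
  simp [redEBCore, limB]

theorem redEEB_zero : redEEB σ θ₀ (A, 0, 0) P = limB θ₀ P + Real.log A.det := by
  simp [redEEB, redEBCore_zero]

theorem redEB_zero : redEB σ θ₀ (A, 0, 0) P = limB θ₀ P + Real.log A.det := by
  rw [redEB, statLS_zero, redEBCore_zero]

end ReducedLimits

/-! ### Joint smoothness of the reduced criteria at the limit statistics -/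

section ReducedSmooth

open scoped Matrix.Norms.Frobenius

variable {E : Type*} [NormedAddCommGroup E] [NormedSpace ℝ E]
  {k : WithTop ℕ∞} {η : E} {Sig : Matrix (Fin n) (Fin n) ℝ}
  {P : E → Matrix (Fin n) (Fin n) ℝ} (σ : ℝ) (θ₀ : Fin n → ℝ)

theorem contDiffAt_stat_gram {x₀ : Stat n} :
    ContDiffAt ℝ k (fun z : Stat n × E => z.1.1) (x₀, η) :=
  contDiffAt_fst.fst

theorem contDiffAt_stat_scale {x₀ : Stat n} :
    ContDiffAt ℝ k (fun z : Stat n × E => z.1.2.1) (x₀, η) :=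
  contDiffAt_fst.snd.fst

theorem contDiffAt_stat_noise {x₀ : Stat n} :
    ContDiffAt ℝ k (fun z : Stat n × E => z.1.2.2) (x₀, η) :=
  contDiffAt_fst.snd.snd

theorem contDiffAt_kernel_inv (hP : ContDiffAt ℝ k P η) (hdet : (P η).det ≠ 0) {x₀ : Stat n} :
    ContDiffAt ℝ k (fun z : Stat n × E => (P z.2)⁻¹) (x₀, η) :=
  ContDiffAt.comp (x₀, η) (g := fun ζ => (P ζ)⁻¹) (contDiffAt_matrix_inv hP hdet) contDiffAt_snd

theorem contDiffAt_scaledGram (hP : ContDiffAt ℝ k P η) (hdet : (P η).det ≠ 0) {x₀ : Stat n} :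
    ContDiffAt ℝ k (fun z : Stat n × E => z.1.1 + (z.1.2.1 * σ ^ 2) • (P z.2)⁻¹) (x₀, η) :=
  contDiffAt_stat_gram.add
    ((contDiffAt_stat_scale.mul contDiffAt_const).smul (contDiffAt_kernel_inv hP hdet))

theorem contDiffAt_scaledInv (hSig : Sig.det ≠ 0) (hP : ContDiffAt ℝ k P η)
    (hdet : (P η).det ≠ 0) :
    ContDiffAt ℝ k (fun z : Stat n × E => scaledInv σ z.1 (P z.2)⁻¹) ((Sig, 0, 0), η) :=
  contDiffAt_matrix_inv (contDiffAt_scaledGram σ hP hdet) (by simpa using hSig)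

theorem contDiffAt_statLS (hSig : Sig.det ≠ 0) :
    ContDiffAt ℝ k (fun z : Stat n × E => statLS θ₀ z.1) ((Sig, 0, 0), η) :=
  contDiffAt_const.add (contDiffAt_mulVec (contDiffAt_matrix_inv contDiffAt_stat_gram hSig)
    contDiffAt_stat_noise)

variable (hSig : Sig.det ≠ 0) (hP : ContDiffAt ℝ k P η) (hdet : (P η).det ≠ 0)
include hSig hP hdet

theorem contDiffAt_redMseG :
    ContDiffAt ℝ k (fun z : Stat n × E => redMseG σ θ₀ z.1 (P z.2)) ((Sig, 0, 0), η) := by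
  have hR := contDiffAt_scaledInv σ hSig hP hdet
  have hK := contDiffAt_kernel_inv hP hdet (x₀ := (Sig, 0, 0))
  have hA := contDiffAt_matrix_inv (contDiffAt_stat_gram (k := k) (η := η)
    (x₀ := (Sig, 0, 0))) hSig
  refine (ContDiffAt.sub ?_ ?_).sub ?_
  · exact contDiffAt_const.mul (contDiffAt_dotProduct contDiffAt_const (contDiffAt_mulVec
      (contDiffAt_matrix_mul (contDiffAt_matrix_mul (contDiffAt_matrix_transpose hK)
        (contDiffAt_matrix_mul hR hR)) hK) contDiffAt_const))
  · exact contDiffAt_const.mul (contDiffAt_matrix_trace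
      (contDiffAt_matrix_mul (contDiffAt_matrix_mul hA hK) hR))
  · exact contDiffAt_const.mul (contDiffAt_matrix_trace
      (contDiffAt_matrix_mul (contDiffAt_matrix_mul hR hK) hR))

theorem contDiffAt_redSureG :
    ContDiffAt ℝ k (fun z : Stat n × E => redSureG σ θ₀ z.1 (P z.2)) ((Sig, 0, 0), η) := by
  have hR := contDiffAt_scaledInv σ hSig hP hdet
  have hK := contDiffAt_kernel_inv hP hdet (x₀ := (Sig, 0, 0))
  have hA := contDiffAt_matrix_inv (contDiffAt_stat_gram (k := k) (η := η)
    (x₀ := (Sig, 0, 0))) hSig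
  have hw := contDiffAt_statLS (k := k) (η := η) θ₀ hSig
  refine ContDiffAt.sub ?_ ?_
  · exact contDiffAt_const.mul (contDiffAt_dotProduct hw (contDiffAt_mulVec
      (contDiffAt_matrix_mul (contDiffAt_matrix_mul (contDiffAt_matrix_transpose hK)
        (contDiffAt_matrix_mul hR hR)) hK) hw))
  · exact contDiffAt_const.mul (contDiffAt_matrix_trace
      (contDiffAt_matrix_mul (contDiffAt_matrix_mul hA hK) hR))

theorem contDiffAt_redMseY :
    ContDiffAt ℝ k (fun z : Stat n × E => redMseY σ θ₀ z.1 (P z.2)) ((Sig, 0, 0), η) := by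
  have hR := contDiffAt_scaledInv σ hSig hP hdet
  have hK := contDiffAt_kernel_inv hP hdet (x₀ := (Sig, 0, 0))
  have hA := contDiffAt_stat_gram (k := k) (η := η) (x₀ := (Sig, 0, 0))
  have hRK := contDiffAt_matrix_mul hR hK
  refine (ContDiffAt.sub ?_ ?_).add ?_
  · exact contDiffAt_const.mul (contDiffAt_dotProduct contDiffAt_const (contDiffAt_mulVec
      (contDiffAt_matrix_mul (contDiffAt_matrix_mul (contDiffAt_matrix_transpose hK)
        (contDiffAt_matrix_mul (contDiffAt_matrix_mul hR hA) hR)) hK) contDiffAt_const))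
  · exact contDiffAt_const.mul (contDiffAt_matrix_trace hRK)
  · exact (contDiffAt_stat_scale.mul contDiffAt_const).mul
      (contDiffAt_matrix_trace (contDiffAt_matrix_mul hRK hRK))

theorem contDiffAt_redSureY :
    ContDiffAt ℝ k (fun z : Stat n × E => redSureY σ θ₀ z.1 (P z.2)) ((Sig, 0, 0), η) := by
  have hR := contDiffAt_scaledInv σ hSig hP hdet
  have hK := contDiffAt_kernel_inv hP hdet (x₀ := (Sig, 0, 0))
  have hA := contDiffAt_stat_gram (k := k) (η := η) (x₀ := (Sig, 0, 0))
  have hw := contDiffAt_statLS (k := k) (η := η) θ₀ hSig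
  refine ContDiffAt.sub ?_ ?_
  · exact contDiffAt_const.mul (contDiffAt_dotProduct hw (contDiffAt_mulVec
      (contDiffAt_matrix_mul (contDiffAt_matrix_mul (contDiffAt_matrix_transpose hK)
        (contDiffAt_matrix_mul (contDiffAt_matrix_mul hR hA) hR)) hK) hw))
  · exact contDiffAt_const.mul (contDiffAt_matrix_trace (contDiffAt_matrix_mul hR hK))

theorem contDiffAt_redEBCore {w : Stat n → Fin n → ℝ}
    (hw : ContDiffAt ℝ k (fun z : Stat n × E => w z.1) ((Sig, 0, 0), η)) :
    ContDiffAt ℝ k (fun z : Stat n × E => redEBCore σ (w z.1) z.1 (P z.2))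
      ((Sig, 0, 0), η) := by
  have hR := contDiffAt_scaledInv σ hSig hP hdet
  have hK := contDiffAt_kernel_inv hP hdet (x₀ := (Sig, 0, 0))
  have hP' : ContDiffAt ℝ k (fun z : Stat n × E => P z.2) ((Sig, 0, 0), η) :=
    ContDiffAt.comp ((Sig, 0, 0), η) hP contDiffAt_snd
  refine (ContDiffAt.add ?_ ?_).add ?_
  · exact contDiffAt_dotProduct hw (contDiffAt_mulVec (hK.sub
      ((contDiffAt_stat_scale.mul contDiffAt_const).smul
        (contDiffAt_matrix_mul (contDiffAt_matrix_mul hK hR) hK))) hw)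
  · exact (contDiffAt_matrix_det hP').log hdet
  · exact (contDiffAt_matrix_det (contDiffAt_scaledGram σ hP hdet)).log (by simpa using hSig)

theorem contDiffAt_redEEB :
    ContDiffAt ℝ k (fun z : Stat n × E => redEEB σ θ₀ z.1 (P z.2)) ((Sig, 0, 0), η) :=
  (contDiffAt_redEBCore σ hSig hP hdet (w := fun _ => θ₀) contDiffAt_const).add
    ((contDiffAt_stat_scale.mul contDiffAt_const).mul (contDiffAt_matrix_trace
      (contDiffAt_matrix_mul (contDiffAt_scaledInv σ hSig hP hdet)
        (contDiffAt_kernel_inv hP hdet))))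

theorem contDiffAt_redEB :
    ContDiffAt ℝ k (fun z : Stat n × E => redEB σ θ₀ z.1 (P z.2)) ((Sig, 0, 0), η) :=
  contDiffAt_redEBCore σ hSig hP hdet (contDiffAt_statLS θ₀ hSig)

end ReducedSmooth

/-! ### Matrix identities -/

theorem sqNorm_eq_dotProduct {ι : Type*} [Fintype ι] (x : ι → ℝ) : sqNorm x = x ⬝ᵥ x := by
  simp [sqNorm, dotProduct, sq]

theorem sqNorm_mulVec {ι κ : Type*} [Fintype ι] [Fintype κ] (M : Matrix κ ι ℝ) (x : ι → ℝ) :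
    sqNorm (M *ᵥ x) = x ⬝ᵥ ((Mᵀ * M) *ᵥ x) := by
  rw [sqNorm_eq_dotProduct, ← Matrix.mulVec_mulVec, Matrix.dotProduct_mulVec x,
    Matrix.vecMul_transpose]

section Identities

variable {n N : ℕ} {σ : ℝ} {Φ : Matrix (Fin N) (Fin n) ℝ} {P : Matrix (Fin n) (Fin n) ℝ}

/-- The regularization term alone gives definiteness, so `R` is invertible even where `ΦᵀΦ` is
singular. -/
theorem Rmat_posDef (hσ : 0 < σ) (hP : P.PosDef) : (Rmat σ Φ P).PosDef := by
  have h1 : (Φᵀ * Φ).PosSemidef := by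
    simpa [Matrix.conjTranspose_eq_transpose_of_trivial]
      using Matrix.posSemidef_conjTranspose_mul_self Φ
  exact Matrix.PosDef.posSemidef_add h1 (hP.inv.smul (by positivity))

theorem Rmat_inv_transpose (hσ : 0 < σ) (hP : P.PosDef) :
    (Rmat σ Φ P)⁻¹ᵀ = (Rmat σ Φ P)⁻¹ := by
  simpa [Matrix.conjTranspose_eq_transpose_of_trivial]
    using (Rmat_posDef (Φ := Φ) hσ hP).inv.isHermitian.eq

theorem Rmat_inv_mul (hσ : 0 < σ) (hP : P.PosDef) : (Rmat σ Φ P)⁻¹ * Rmat σ Φ P = 1 :=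
  Matrix.nonsing_inv_mul _ (Rmat_posDef hσ hP).det_pos.ne'.isUnit

theorem Rmat_mul_inv (hσ : 0 < σ) (hP : P.PosDef) : Rmat σ Φ P * (Rmat σ Φ P)⁻¹ = 1 :=
  Matrix.mul_nonsing_inv _ (Rmat_posDef hσ hP).det_pos.ne'.isUnit

/-- With its mirror image below, this is the source of the reductions: each occurrence of `ΦᵀΦ` next
to `R⁻¹` is traded for an identity term free of `P` and a smaller remainder. -/
theorem Rmat_inv_mul_gram (hσ : 0 < σ) (hP : P.PosDef) :
    (Rmat σ Φ P)⁻¹ * (Φᵀ * Φ) = 1 - σ ^ 2 • ((Rmat σ Φ P)⁻¹ * P⁻¹) := by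
  have h := Rmat_inv_mul (Φ := Φ) hσ hP
  nth_rewrite 2 [Rmat] at h
  rw [mul_add, mul_smul_comm] at h
  exact eq_sub_of_add_eq h

theorem gram_mul_Rmat_inv (hσ : 0 < σ) (hP : P.PosDef) :
    Φᵀ * Φ * (Rmat σ Φ P)⁻¹ = 1 - σ ^ 2 • (P⁻¹ * (Rmat σ Φ P)⁻¹) := by
  have h := Rmat_mul_inv (Φ := Φ) hσ hP
  nth_rewrite 1 [Rmat] at h
  rw [add_mul, smul_mul_assoc] at h
  exact eq_sub_of_add_eq h

/-- The Woodbury identity, which replaces the growing `N × N` inverse by an `n × n` one. -/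
theorem Qmat_inv (hσ : 0 < σ) (hP : P.PosDef) :
    (Qmat σ Φ P)⁻¹ = (σ ^ 2)⁻¹ • (1 - Φ * (Rmat σ Φ P)⁻¹ * Φᵀ) := by
  refine Matrix.inv_eq_right_inv ?_
  have hPP : P * P⁻¹ = 1 := Matrix.mul_nonsing_inv _ hP.det_pos.ne'.isUnit
  have h2 : Φ * P * Φᵀ * (Φ * (Rmat σ Φ P)⁻¹ * Φᵀ)
      = Φ * P * Φᵀ - σ ^ 2 • (Φ * (Rmat σ Φ P)⁻¹ * Φᵀ) := by
    calc Φ * P * Φᵀ * (Φ * (Rmat σ Φ P)⁻¹ * Φᵀ)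
        = Φ * P * (Φᵀ * Φ * (Rmat σ Φ P)⁻¹) * Φᵀ := by simp only [Matrix.mul_assoc]
      _ = Φ * P * Φᵀ - σ ^ 2 • (Φ * (P * P⁻¹) * (Rmat σ Φ P)⁻¹ * Φᵀ) := by
        rw [gram_mul_Rmat_inv hσ hP]
        simp only [Matrix.sub_mul, Matrix.mul_sub, Matrix.mul_one, Matrix.mul_smul, Matrix.smul_mul, Matrix.mul_assoc]
      _ = _ := by rw [hPP, Matrix.mul_one]
  rw [Qmat, Matrix.mul_smul, Matrix.mul_sub, Matrix.add_mul, Matrix.add_mul, h2]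
  rw [Matrix.mul_one, Matrix.mul_one, Matrix.smul_mul, Matrix.one_mul, sub_add_cancel,
    add_sub_cancel_left, smul_smul, inv_mul_cancel₀ (by positivity), one_smul]

theorem rls_gain (hσ : 0 < σ) (hP : P.PosDef) :
    P * Φᵀ * (Qmat σ Φ P)⁻¹ = (Rmat σ Φ P)⁻¹ * Φᵀ := by
  have hPP : P * P⁻¹ = 1 := Matrix.mul_nonsing_inv _ hP.det_pos.ne'.isUnit
  have h : P * Φᵀ * (Φ * (Rmat σ Φ P)⁻¹ * Φᵀ)
      = P * Φᵀ - σ ^ 2 • ((Rmat σ Φ P)⁻¹ * Φᵀ) := by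
    calc P * Φᵀ * (Φ * (Rmat σ Φ P)⁻¹ * Φᵀ)
        = P * (Φᵀ * Φ * (Rmat σ Φ P)⁻¹) * Φᵀ := by simp only [Matrix.mul_assoc]
      _ = P * Φᵀ - σ ^ 2 • (P * P⁻¹ * (Rmat σ Φ P)⁻¹ * Φᵀ) := by
        rw [gram_mul_Rmat_inv hσ hP]
        simp only [mul_sub, Matrix.sub_mul, mul_one, Matrix.mul_smul, Matrix.smul_mul,
          Matrix.mul_assoc]
      _ = _ := by rw [hPP, Matrix.one_mul]
  rw [Qmat_inv hσ hP, Matrix.mul_smul, Matrix.mul_sub, h, Matrix.mul_one, sub_sub_cancel,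
    smul_smul, inv_mul_cancel₀ (by positivity), one_smul]

theorem rlsEst_eq (hσ : 0 < σ) (hP : P.PosDef) (Y : Fin N → ℝ) :
    rlsEst σ Φ P Y = ((Rmat σ Φ P)⁻¹ * Φᵀ) *ᵥ Y := by
  rw [rlsEst, rls_gain hσ hP]

/-- The bias and the noise part of the regularized estimate. -/
theorem rlsEst_sub (hσ : 0 < σ) (hP : P.PosDef) (θ : Fin n → ℝ) (V : Fin N → ℝ) :
    rlsEst σ Φ P (Φ *ᵥ θ + V) - θ
      = -(σ ^ 2 • (((Rmat σ Φ P)⁻¹ * P⁻¹) *ᵥ θ)) + ((Rmat σ Φ P)⁻¹ * Φᵀ) *ᵥ V := by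
  rw [rlsEst_eq hσ hP, Matrix.mulVec_add, Matrix.mulVec_mulVec, Matrix.mul_assoc,
    Rmat_inv_mul_gram hσ hP, Matrix.sub_mulVec, Matrix.one_mulVec, Matrix.smul_mulVec]
  abel

theorem lsEst_add (hG : (Φᵀ * Φ).det ≠ 0) (θ : Fin n → ℝ) (V : Fin N → ℝ) :
    lsEst Φ (Φ *ᵥ θ + V) = θ + (Φᵀ * Φ)⁻¹ *ᵥ (Φᵀ *ᵥ V) := by
  rw [lsEst, Matrix.mulVec_add, Matrix.mulVec_mulVec, Matrix.mul_assoc,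
    Matrix.nonsing_inv_mul _ hG.isUnit, Matrix.one_mulVec, Matrix.mulVec_mulVec]

theorem gram_mulVec_lsEst (hG : (Φᵀ * Φ).det ≠ 0) (Y : Fin N → ℝ) :
    (Φᵀ * Φ) *ᵥ lsEst Φ Y = Φᵀ *ᵥ Y := by
  rw [lsEst, Matrix.mulVec_mulVec, ← Matrix.mul_assoc, Matrix.mul_nonsing_inv _ hG.isUnit,
    Matrix.one_mul]

theorem lsEst_sub_rlsEst (hσ : 0 < σ) (hP : P.PosDef) (hG : (Φᵀ * Φ).det ≠ 0)
    (Y : Fin N → ℝ) :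
    lsEst Φ Y - rlsEst σ Φ P Y = σ ^ 2 • (((Rmat σ Φ P)⁻¹ * P⁻¹) *ᵥ lsEst Φ Y) := by
  rw [rlsEst_eq hσ hP, ← Matrix.mulVec_mulVec, ← gram_mulVec_lsEst hG, Matrix.mulVec_mulVec,
    Rmat_inv_mul_gram hσ hP, Matrix.sub_mulVec, Matrix.one_mulVec, Matrix.smul_mulVec]
  abel

/-- A resolvent identity that isolates the leading part of `R⁻¹`, free of `P`. -/
theorem Rmat_inv_sub_gram_inv (hσ : 0 < σ) (hP : P.PosDef) (hG : (Φᵀ * Φ).det ≠ 0) :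
    (Rmat σ Φ P)⁻¹ = (Φᵀ * Φ)⁻¹ - σ ^ 2 • ((Φᵀ * Φ)⁻¹ * P⁻¹ * (Rmat σ Φ P)⁻¹) := by
  have h := congrArg (fun M => (Φᵀ * Φ)⁻¹ * M) (gram_mul_Rmat_inv (Φ := Φ) hσ hP)
  rw [← Matrix.mul_assoc, Matrix.nonsing_inv_mul _ hG.isUnit, Matrix.one_mul, mul_sub, mul_one,
    mul_smul_comm] at h
  rw [Matrix.mul_assoc]
  exact h

theorem trace_Rmat_gram_Rmat (hσ : 0 < σ) (hP : P.PosDef) (hG : (Φᵀ * Φ).det ≠ 0) :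
    ((Rmat σ Φ P)⁻¹ * (Φᵀ * Φ) * (Rmat σ Φ P)⁻¹).trace = ((Φᵀ * Φ)⁻¹).trace
      - σ ^ 2 * ((Φᵀ * Φ)⁻¹ * P⁻¹ * (Rmat σ Φ P)⁻¹).trace
      - σ ^ 2 * ((Rmat σ Φ P)⁻¹ * P⁻¹ * (Rmat σ Φ P)⁻¹).trace := by
  rw [Rmat_inv_mul_gram hσ hP, sub_mul, one_mul, smul_mul_assoc, Matrix.trace_sub,
    Matrix.trace_smul, smul_eq_mul]
  have h := congrArg Matrix.trace (Rmat_inv_sub_gram_inv (Φ := Φ) hσ hP hG)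
  rw [Matrix.trace_sub, Matrix.trace_smul, smul_eq_mul] at h
  rw [← h]

theorem trace_Rmat_gram_sq (hσ : 0 < σ) (hP : P.PosDef) :
    ((Rmat σ Φ P)⁻¹ * (Φᵀ * Φ) * ((Rmat σ Φ P)⁻¹ * (Φᵀ * Φ))).trace
      = n - 2 * σ ^ 2 * ((Rmat σ Φ P)⁻¹ * P⁻¹).trace
        + σ ^ 4 * ((Rmat σ Φ P)⁻¹ * P⁻¹ * ((Rmat σ Φ P)⁻¹ * P⁻¹)).trace := by
  rw [Rmat_inv_mul_gram hσ hP, sub_mul, mul_sub, mul_sub, one_mul, mul_one, one_mul,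
    smul_mul_smul_comm]
  simp only [Matrix.trace_sub, Matrix.trace_smul, Matrix.trace_one, Fintype.card_fin,
    smul_eq_mul]
  ring

theorem gram_Rmat_gram (hσ : 0 < σ) (hP : P.PosDef) :
    Φᵀ * Φ * (Rmat σ Φ P)⁻¹ * (Φᵀ * Φ)
      = Φᵀ * Φ - σ ^ 2 • P⁻¹ + σ ^ 4 • (P⁻¹ * (Rmat σ Φ P)⁻¹ * P⁻¹) := by
  rw [Matrix.mul_assoc, Rmat_inv_mul_gram hσ hP, mul_sub, mul_one, mul_smul_comm,
    ← Matrix.mul_assoc, gram_mul_Rmat_inv hσ hP, sub_mul, one_mul, smul_mul_assoc, smul_sub,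
    smul_smul]
  rw [← pow_add, sub_sub_eq_add_sub, sub_add_eq_add_sub]

/-- Sylvester's identity `det (1 + AB) = det (1 + BA)` brings the determinant down to size `n`. -/
theorem log_det_Qmat (hσ : 0 < σ) (hP : P.PosDef) :
    Real.log (Qmat σ Φ P).det = (N - n) * Real.log (σ ^ 2) + Real.log P.det
      + Real.log (Rmat σ Φ P).det := by
  have hPP : P⁻¹ * P = 1 := Matrix.nonsing_inv_mul _ hP.det_pos.ne'.isUnit
  have hs : (σ ^ 2) ≠ 0 := by positivity
  have h1 : Qmat σ Φ P = σ ^ 2 • (1 + (Φ * P) * ((σ ^ 2)⁻¹ • Φᵀ)) := by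
    rw [Qmat, smul_add, Matrix.mul_smul, smul_smul, mul_inv_cancel₀ hs, one_smul, add_comm]
  have h2 : 1 + ((σ ^ 2)⁻¹ • Φᵀ) * (Φ * P) = (σ ^ 2)⁻¹ • (Rmat σ Φ P * P) := by
    rw [Rmat, add_mul, smul_mul_assoc, hPP, smul_add, smul_smul, inv_mul_cancel₀ hs, one_smul,
      Matrix.smul_mul, Matrix.mul_assoc, add_comm]
  have hR := (Rmat_posDef (Φ := Φ) hσ hP).det_pos
  have hp := hP.det_pos
  rw [h1, Matrix.det_smul, Matrix.det_one_add_mul_comm, h2, Matrix.det_smul, Matrix.det_mul,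
    Fintype.card_fin, Fintype.card_fin, Real.log_mul (by positivity) (by positivity),
    Real.log_mul (by positivity) (by positivity), Real.log_mul (by positivity) (by positivity),
    Real.log_pow (σ ^ 2) N, Real.log_pow (σ ^ 2)⁻¹ n, Real.log_inv]
  ring

theorem quad_Qmat_inv (hσ : 0 < σ) (hP : P.PosDef) (w : Fin n → ℝ) :
    (Φ *ᵥ w) ⬝ᵥ ((Qmat σ Φ P)⁻¹ *ᵥ (Φ *ᵥ w))
      = w ⬝ᵥ ((P⁻¹ - σ ^ 2 • (P⁻¹ * (Rmat σ Φ P)⁻¹ * P⁻¹)) *ᵥ w) := by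
  have h : Φᵀ * (Qmat σ Φ P)⁻¹ * Φ = P⁻¹ - σ ^ 2 • (P⁻¹ * (Rmat σ Φ P)⁻¹ * P⁻¹) := by
    have h0 : Φᵀ * (Qmat σ Φ P)⁻¹ * Φ
        = (σ ^ 2)⁻¹ • (Φᵀ * Φ - Φᵀ * Φ * (Rmat σ Φ P)⁻¹ * (Φᵀ * Φ)) := by
      rw [Qmat_inv hσ hP, Matrix.mul_smul, Matrix.smul_mul, Matrix.mul_sub, Matrix.sub_mul,
        Matrix.mul_one]
      simp only [Matrix.mul_assoc]
    rw [h0, gram_Rmat_gram hσ hP, ← sub_sub, sub_sub_cancel, smul_sub, smul_smul, smul_smul,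
      inv_mul_cancel₀ (by positivity), one_smul]
    congr 2
    field_simp
  rw [← h, Matrix.dotProduct_mulVec, Matrix.vecMul_mulVec, ← Matrix.dotProduct_mulVec,
    Matrix.mulVec_mulVec]

theorem transpose_mulVec_residual (hG : (Φᵀ * Φ).det ≠ 0) (Y : Fin N → ℝ) :
    Φᵀ *ᵥ (Y - Φ *ᵥ lsEst Φ Y) = 0 := by
  rw [Matrix.mulVec_sub, Matrix.mulVec_mulVec, gram_mulVec_lsEst hG, sub_self]

theorem residual_dotProduct (hG : (Φᵀ * Φ).det ≠ 0) (Y : Fin N → ℝ) (w : Fin n → ℝ) :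
    (Y - Φ *ᵥ lsEst Φ Y) ⬝ᵥ (Φ *ᵥ w) = 0 := by
  rw [Matrix.dotProduct_mulVec, ← Matrix.mulVec_transpose, transpose_mulVec_residual hG,
    zero_dotProduct]

/-- The least squares residual is orthogonal to the range of `Φ`, where `Q` acts as `σ²` whatever
`P` is. -/
theorem Qmat_inv_mulVec_residual (hσ : 0 < σ) (hP : P.PosDef) (hG : (Φᵀ * Φ).det ≠ 0)
    (Y : Fin N → ℝ) :
    (Qmat σ Φ P)⁻¹ *ᵥ (Y - Φ *ᵥ lsEst Φ Y) = (σ ^ 2)⁻¹ • (Y - Φ *ᵥ lsEst Φ Y) := by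
  rw [Qmat_inv hσ hP, Matrix.smul_mulVec, Matrix.sub_mulVec, Matrix.one_mulVec,
    ← Matrix.mulVec_mulVec _ _ Φᵀ, transpose_mulVec_residual hG, Matrix.mulVec_zero, sub_zero]

theorem Qmat_inv_transpose (hσ : 0 < σ) (hP : P.PosDef) :
    (Qmat σ Φ P)⁻¹ᵀ = (Qmat σ Φ P)⁻¹ := by
  rw [Qmat_inv hσ hP, Matrix.transpose_smul, Matrix.transpose_sub, Matrix.transpose_one,
    Matrix.transpose_mul, Matrix.transpose_mul, Matrix.transpose_transpose,
    Rmat_inv_transpose hσ hP, Matrix.mul_assoc]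

/-- Splits `Y` into least squares fit and residual; the cross terms vanish and the residual part
does not involve `P`, so `Y` matters only through `lsEst Φ Y`. -/
theorem quad_output (hσ : 0 < σ) (hP : P.PosDef) (hG : (Φᵀ * Φ).det ≠ 0) (Y : Fin N → ℝ) :
    Y ⬝ᵥ ((Qmat σ Φ P)⁻¹ *ᵥ Y)
      = lsEst Φ Y ⬝ᵥ ((P⁻¹ - σ ^ 2 • (P⁻¹ * (Rmat σ Φ P)⁻¹ * P⁻¹)) *ᵥ lsEst Φ Y)
        + (σ ^ 2)⁻¹ * sqNorm (Y - Φ *ᵥ lsEst Φ Y) := by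
  set w := lsEst Φ Y with hw
  set e := Y - Φ *ᵥ w with he
  have hY : Y = Φ *ᵥ w + e := by rw [he]; abel
  have h1 : (Qmat σ Φ P)⁻¹ *ᵥ e = (σ ^ 2)⁻¹ • e := Qmat_inv_mulVec_residual hσ hP hG Y
  have h2 : ∀ z, e ⬝ᵥ (Φ *ᵥ z) = 0 := residual_dotProduct hG Y
  have h3 : e ⬝ᵥ ((Qmat σ Φ P)⁻¹ *ᵥ (Φ *ᵥ w)) = 0 := by
    rw [Matrix.dotProduct_mulVec, ← Matrix.mulVec_transpose, Qmat_inv_transpose hσ hP, h1,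
      smul_dotProduct, h2, smul_zero]
  have h4 : (Φ *ᵥ w) ⬝ᵥ e = 0 := by rw [dotProduct_comm, h2]
  conv_lhs => rw [hY]
  rw [Matrix.mulVec_add, h1, add_dotProduct, dotProduct_add, dotProduct_add,
    quad_Qmat_inv hσ hP, h3, dotProduct_smul, h4, dotProduct_smul, sqNorm_eq_dotProduct]
  simp

/-! ### Scaling -/

/-- The triple `(Φᵀ Φ / N, 1 / N, Φᵀ V / N)`. -/
def stat (Φ : Matrix (Fin N) (Fin n) ℝ) (V : Fin N → ℝ) : Stat n :=
  ((N : ℝ)⁻¹ • (Φᵀ * Φ), (N : ℝ)⁻¹, (N : ℝ)⁻¹ • (Φᵀ *ᵥ V))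

/-- The pair `(Φᵀ Φ / N, 1 / N)`, with zero noise component. -/
def noiselessStat (Φ : Matrix (Fin N) (Fin n) ℝ) : Stat n :=
  ((N : ℝ)⁻¹ • (Φᵀ * Φ), (N : ℝ)⁻¹, 0)

theorem inv_smul_inv {c : ℝ} (hc : c ≠ 0) {M : Matrix (Fin n) (Fin n) ℝ} (hM : M.det ≠ 0) :
    (c⁻¹ • M)⁻¹ = c • M⁻¹ := by
  refine Matrix.inv_eq_right_inv ?_
  rw [smul_mul_smul_comm, Matrix.mul_nonsing_inv _ hM.isUnit, inv_mul_cancel₀ hc, one_smul]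

theorem scaledGram_eq (K : Matrix (Fin n) (Fin n) ℝ) :
    (N : ℝ)⁻¹ • (Φᵀ * Φ) + ((N : ℝ)⁻¹ * σ ^ 2) • K
      = (N : ℝ)⁻¹ • (Φᵀ * Φ + σ ^ 2 • K) := by
  rw [smul_add, smul_smul]

theorem scaledInv_eq (hN : N ≠ 0) (hσ : 0 < σ) (hP : P.PosDef) (b : Fin n → ℝ) :
    scaledInv σ ((N : ℝ)⁻¹ • (Φᵀ * Φ), (N : ℝ)⁻¹, b) P⁻¹ = (N : ℝ) • (Rmat σ Φ P)⁻¹ := by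
  rw [scaledInv, scaledGram_eq]
  exact inv_smul_inv (Nat.cast_ne_zero.2 hN) (Rmat_posDef hσ hP).det_pos.ne'

theorem statLS_stat (hN : N ≠ 0) (hG : (Φᵀ * Φ).det ≠ 0) (θ : Fin n → ℝ) (V : Fin N → ℝ) :
    statLS θ (stat Φ V) = lsEst Φ (Φ *ᵥ θ + V) := by
  have hN' : (N : ℝ) ≠ 0 := Nat.cast_ne_zero.2 hN
  rw [lsEst_add hG, statLS, stat, inv_smul_inv hN' hG, Matrix.smul_mulVec, Matrix.mulVec_smul,
    smul_smul, mul_inv_cancel₀ hN', one_smul]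

theorem log_det_scaledGram (hN : N ≠ 0) (hσ : 0 < σ) (hP : P.PosDef) :
    Real.log ((N : ℝ)⁻¹ • (Φᵀ * Φ) + ((N : ℝ)⁻¹ * σ ^ 2) • P⁻¹).det
      = Real.log (Rmat σ Φ P).det - n * Real.log N := by
  have hN' : (N : ℝ) ≠ 0 := Nat.cast_ne_zero.2 hN
  rw [scaledGram_eq, ← Rmat, Matrix.det_smul, Fintype.card_fin,
    Real.log_mul (by positivity) (Rmat_posDef hσ hP).det_pos.ne', Real.log_pow, Real.log_inv]
  ring

theorem redEBCore_eq (hN : N ≠ 0) (hσ : 0 < σ) (hP : P.PosDef) (w b : Fin n → ℝ) :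
    redEBCore σ w ((N : ℝ)⁻¹ • (Φᵀ * Φ), (N : ℝ)⁻¹, b) P
      = w ⬝ᵥ ((P⁻¹ - σ ^ 2 • (P⁻¹ * (Rmat σ Φ P)⁻¹ * P⁻¹)) *ᵥ w)
        + Real.log (Qmat σ Φ P).det - ((N - n) * Real.log (σ ^ 2) + n * Real.log N) := by
  have hN' : (N : ℝ) ≠ 0 := Nat.cast_ne_zero.2 hN
  rw [redEBCore, scaledInv_eq hN hσ hP, log_det_Qmat hσ hP]
  simp only
  rw [log_det_scaledGram hN hσ hP, Matrix.mul_smul, Matrix.smul_mul, smul_smul]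
  have : (N : ℝ)⁻¹ * σ ^ 2 * N = σ ^ 2 := by field_simp
  rw [this]
  ring

/-! ### The data criteria in terms of the statistics -/

theorem critEB_eq (hN : N ≠ 0) (hσ : 0 < σ) (hP : P.PosDef) (hG : (Φᵀ * Φ).det ≠ 0)
    (θ : Fin n → ℝ) (V : Fin N → ℝ) :
    critEB σ Φ (Φ *ᵥ θ + V) P = redEB σ θ (stat Φ V) P
      + ((σ ^ 2)⁻¹ * sqNorm (Φ *ᵥ θ + V - Φ *ᵥ lsEst Φ (Φ *ᵥ θ + V))
        + ((N - n) * Real.log (σ ^ 2) + n * Real.log N)) := by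
  rw [critEB, redEB, statLS_stat hN hG, stat, redEBCore_eq hN hσ hP, quad_output hσ hP hG]
  ring

theorem sureG_eq (hN : N ≠ 0) (hσ : 0 < σ) (hP : P.PosDef) (hG : (Φᵀ * Φ).det ≠ 0)
    (θ : Fin n → ℝ) (V : Fin N → ℝ) :
    sureG σ Φ (Φ *ᵥ θ + V) P = ((N : ℝ) ^ 2)⁻¹ * redSureG σ θ (stat Φ V) P
      + σ ^ 2 * ((Φᵀ * Φ)⁻¹).trace := by
  have hN' : (N : ℝ) ≠ 0 := Nat.cast_ne_zero.2 hN
  have ht := congrArg Matrix.trace (Rmat_inv_sub_gram_inv (Φ := Φ) hσ hP hG)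
  rw [Matrix.trace_sub, Matrix.trace_smul, smul_eq_mul] at ht
  rw [sureG, lsEst_sub_rlsEst hσ hP hG, ← Matrix.smul_mulVec, sqNorm_mulVec, redSureG,
    statLS_stat hN hG, stat, scaledInv_eq hN hσ hP, inv_smul_inv hN' hG, Matrix.transpose_smul,
    Matrix.transpose_mul, Rmat_inv_transpose hσ hP, Matrix.trace_sub, Matrix.trace_smul, ht]
  simp only [Matrix.smul_mul, Matrix.mul_smul, smul_smul, Matrix.smul_mulVec, dotProduct_smul,
    Matrix.trace_smul, smul_eq_mul, Matrix.mul_assoc]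
  field_simp
  ring

theorem trace_fit (hσ : 0 < σ) (hP : P.PosDef) :
    (Φ * P * Φᵀ * (Qmat σ Φ P)⁻¹).trace = n - σ ^ 2 * ((Rmat σ Φ P)⁻¹ * P⁻¹).trace := by
  have h : Φ * P * Φᵀ * (Qmat σ Φ P)⁻¹ = Φ * ((Rmat σ Φ P)⁻¹ * Φᵀ) := by
    rw [← rls_gain hσ hP]; simp only [Matrix.mul_assoc]
  rw [h, Matrix.trace_mul_comm, Matrix.mul_assoc, Rmat_inv_mul_gram hσ hP, Matrix.trace_sub,
    Matrix.trace_smul, Matrix.trace_one, Fintype.card_fin, smul_eq_mul]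

/-- Pythagoras: the residual of the regularized fit is the least squares residual plus an orthogonal
vector in the range of `Φ`. -/
theorem sureY_eq (hN : N ≠ 0) (hσ : 0 < σ) (hP : P.PosDef) (hG : (Φᵀ * Φ).det ≠ 0)
    (θ : Fin n → ℝ) (V : Fin N → ℝ) :
    sureY σ Φ (Φ *ᵥ θ + V) P = (N : ℝ)⁻¹ * redSureY σ θ (stat Φ V) P
      + (sqNorm (Φ *ᵥ θ + V - Φ *ᵥ lsEst Φ (Φ *ᵥ θ + V)) + 2 * σ ^ 2 * n) := by
  have hN' : (N : ℝ) ≠ 0 := Nat.cast_ne_zero.2 hN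
  set Y := Φ *ᵥ θ + V
  set w := lsEst Φ Y with hw
  have h1 : Y - Φ *ᵥ rlsEst σ Φ P Y
      = (Y - Φ *ᵥ w) + Φ *ᵥ (σ ^ 2 • (((Rmat σ Φ P)⁻¹ * P⁻¹) *ᵥ w)) := by
    rw [← lsEst_sub_rlsEst hσ hP hG, Matrix.mulVec_sub]; abel
  have h2 : sqNorm (Y - Φ *ᵥ rlsEst σ Φ P Y) = sqNorm (Y - Φ *ᵥ w)
      + sqNorm (Φ *ᵥ (σ ^ 2 • (((Rmat σ Φ P)⁻¹ * P⁻¹) *ᵥ w))) := by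
    rw [h1]
    simp only [sqNorm_eq_dotProduct, add_dotProduct, dotProduct_add]
    rw [residual_dotProduct hG, dotProduct_comm (Φ *ᵥ _) (Y - _), residual_dotProduct hG]
    ring
  rw [sureY, h2, trace_fit hσ hP, ← Matrix.smul_mulVec, Matrix.mulVec_mulVec, sqNorm_mulVec,
    redSureY, statLS_stat hN hG, stat, scaledInv_eq hN hσ hP, Matrix.transpose_mul,
    Matrix.transpose_smul, Matrix.transpose_mul, Rmat_inv_transpose hσ hP]
  simp only [Matrix.smul_mul, Matrix.mul_smul, smul_smul, Matrix.smul_mulVec, dotProduct_smul,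
    Matrix.trace_smul, smul_eq_mul, Matrix.mul_assoc]
  field_simp
  ring

end Identities

/-! ### Expectations of quadratic expressions in the noise -/

/-- A finite family of square integrable, centred, uncorrelated random variables with common
variance `σ ^ 2`. -/
structure IsWhiteVec {T ι : Type*} [MeasurableSpace T] [DecidableEq ι] (ν : Measure T)
    (Z : T → ι → ℝ) (σ : ℝ) : Prop where
  memLp : ∀ i, MemLp (fun t => Z t i) 2 ν
  integral_eq_zero : ∀ i, ∫ t, Z t i ∂ν = 0
  integral_mul : ∀ i j, ∫ t, Z t i * Z t j ∂ν = if i = j then σ ^ 2 else 0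

section White

variable {T ι κ : Type*} [MeasurableSpace T] [Fintype ι] [DecidableEq ι] [Fintype κ]
  {ν : Measure T} [IsProbabilityMeasure ν] {Z : T → ι → ℝ} {σ : ℝ}

theorem IsWhiteVec.memLp_affine (hZ : IsWhiteVec ν Z σ) (α : ℝ) (c : ι → ℝ) :
    MemLp (fun t => α + c ⬝ᵥ Z t) 2 ν :=
  (memLp_const α).add (memLp_finsetSum _ fun i _ => (hZ.memLp i).const_mul (c i))

theorem IsWhiteVec.integral_affine (hZ : IsWhiteVec ν Z σ) (α : ℝ) (c : ι → ℝ) :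
    ∫ t, (α + c ⬝ᵥ Z t) ∂ν = α := by
  have hint : ∀ i ∈ Finset.univ, Integrable (fun t => c i * Z t i) ν := fun i _ =>
    ((hZ.memLp i).integrable (by norm_num)).const_mul _
  simp only [dotProduct]
  rw [integral_add (integrable_const α) (integrable_finsetSum _ hint),
    integral_finsetSum _ hint]
  simp [integral_const_mul, hZ.integral_eq_zero]

omit [IsProbabilityMeasure ν] in
theorem IsWhiteVec.integral_mul_dotProduct (hZ : IsWhiteVec ν Z σ) (i : ι) (d : ι → ℝ) :
    ∫ t, Z t i * (d ⬝ᵥ Z t) ∂ν = σ ^ 2 * d i := by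
  have hint : ∀ j ∈ Finset.univ, Integrable (fun t => d j * (Z t i * Z t j)) ν := fun j _ =>
    ((hZ.memLp i).integrable_mul (hZ.memLp j)).const_mul _
  have : (fun t => Z t i * (d ⬝ᵥ Z t)) = fun t => ∑ j, d j * (Z t i * Z t j) := by
    funext t
    rw [dotProduct, Finset.mul_sum]
    exact Finset.sum_congr rfl fun j _ => by ring
  rw [this, integral_finsetSum _ hint]
  simp [integral_const_mul, hZ.integral_mul, mul_comm]

theorem IsWhiteVec.integral_affine_mul_affine (hZ : IsWhiteVec ν Z σ) (α β : ℝ)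
    (c d : ι → ℝ) :
    ∫ t, (α + c ⬝ᵥ Z t) * (β + d ⬝ᵥ Z t) ∂ν = α * β + σ ^ 2 * (c ⬝ᵥ d) := by
  have hd : MemLp (fun t => d ⬝ᵥ Z t) 2 ν := by simpa using hZ.memLp_affine 0 d
  have hint : ∀ i ∈ Finset.univ, Integrable (fun t => c i * (Z t i * (d ⬝ᵥ Z t))) ν :=
    fun i _ => ((hZ.memLp i).integrable_mul hd).const_mul _
  have : (fun t => (α + c ⬝ᵥ Z t) * (β + d ⬝ᵥ Z t))
      = fun t => (α * β + (α • d + β • c) ⬝ᵥ Z t) + ∑ i, c i * (Z t i * (d ⬝ᵥ Z t)) := by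
    funext t
    have h1 : ∑ i, c i * (Z t i * (d ⬝ᵥ Z t)) = (c ⬝ᵥ Z t) * (d ⬝ᵥ Z t) := by
      rw [show c ⬝ᵥ Z t = ∑ i, c i * Z t i from rfl, Finset.sum_mul]
      exact Finset.sum_congr rfl fun j _ => by ring
    rw [h1, add_dotProduct, smul_dotProduct, smul_dotProduct, smul_eq_mul, smul_eq_mul]
    ring
  rw [this, integral_add ((hZ.memLp_affine _ _).integrable (by norm_num))
    (integrable_finsetSum _ hint), hZ.integral_affine, integral_finsetSum _ hint]
  simp only [integral_const_mul, hZ.integral_mul_dotProduct]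
  rw [dotProduct, Finset.mul_sum]
  congr 1
  exact Finset.sum_congr rfl fun j _ => by ring

theorem IsWhiteVec.integrable_dotProduct (hZ : IsWhiteVec ν Z σ) (a b : κ → ℝ)
    (A B : Matrix κ ι ℝ) :
    Integrable (fun t => (a + A *ᵥ Z t) ⬝ᵥ (b + B *ᵥ Z t)) ν :=
  integrable_finsetSum _ fun k _ =>
    (hZ.memLp_affine (a k) (A k)).integrable_mul (hZ.memLp_affine (b k) (B k))

theorem IsWhiteVec.integral_dotProduct (hZ : IsWhiteVec ν Z σ) (a b : κ → ℝ)
    (A B : Matrix κ ι ℝ) :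
    ∫ t, (a + A *ᵥ Z t) ⬝ᵥ (b + B *ᵥ Z t) ∂ν = a ⬝ᵥ b + σ ^ 2 * (A * Bᵀ).trace := by
  have hint : ∀ k ∈ Finset.univ, Integrable
      (fun t => (a k + A k ⬝ᵥ Z t) * (b k + B k ⬝ᵥ Z t)) ν := fun k _ =>
    (hZ.memLp_affine (a k) (A k)).integrable_mul (hZ.memLp_affine (b k) (B k))
  have : (fun t => (a + A *ᵥ Z t) ⬝ᵥ (b + B *ᵥ Z t))
      = fun t => ∑ k, (a k + A k ⬝ᵥ Z t) * (b k + B k ⬝ᵥ Z t) := rfl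
  rw [this, integral_finsetSum _ hint]
  simp only [hZ.integral_affine_mul_affine, Finset.sum_add_distrib, ← Finset.mul_sum]
  rfl

theorem IsWhiteVec.integral_sqNorm (hZ : IsWhiteVec ν Z σ) (a : κ → ℝ) (A : Matrix κ ι ℝ) :
    ∫ t, sqNorm (a + A *ᵥ Z t) ∂ν = sqNorm a + σ ^ 2 * (A * Aᵀ).trace := by
  simp only [sqNorm_eq_dotProduct]
  exact hZ.integral_dotProduct a a A A

omit [Fintype ι] in
/-- Two independent copies of a white vector form a white vector. -/
theorem IsWhiteVec.prod (hZ : IsWhiteVec ν Z σ) :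
    IsWhiteVec (ν.prod ν) (fun z : T × T => Sum.elim (Z z.1) (Z z.2)) σ where
  memLp := by
    rintro (i | i)
    · exact (hZ.memLp i).comp_fst ν
    · exact (hZ.memLp i).comp_snd ν
  integral_eq_zero := by
    rintro (i | i)
    · simpa [hZ.integral_eq_zero] using integral_fun_fst (μ := ν) (ν := ν) fun t => Z t i
    · simpa [hZ.integral_eq_zero] using integral_fun_snd (μ := ν) (ν := ν) fun t => Z t i
  integral_mul := by
    rintro (i | i) (j | j)
    · simpa [hZ.integral_mul] using
        integral_fun_fst (μ := ν) (ν := ν) fun t => Z t i * Z t j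
    · simpa [hZ.integral_eq_zero] using
        integral_prod_mul (μ := ν) (ν := ν) (fun t => Z t i) fun t => Z t j
    · simpa [hZ.integral_eq_zero, mul_comm] using
        integral_prod_mul (μ := ν) (ν := ν) (fun t => Z t j) fun t => Z t i
    · simpa [hZ.integral_mul] using
        integral_fun_snd (μ := ν) (ν := ν) fun t => Z t i * Z t j

end White

theorem IsWhiteNoise.isWhiteVec {S : Type*} [MeasurableSpace S] {μ : Measure S}
    {v : ℕ → S → ℝ} {σ : ℝ} (h : IsWhiteNoise μ v σ) (N : ℕ) :
    IsWhiteVec μ (noiseVec v N) σ where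
  memLp i := h.1 _ (Nat.succ_pos _)
  integral_eq_zero i := h.2.1 _ (Nat.succ_pos _)
  integral_mul i j := by
    by_cases hij : i = j
    · subst hij
      simpa [noiseVec, sq] using h.2.2.1 ((i : ℕ) + 1) (Nat.succ_pos _)
    · rw [if_neg hij]
      exact h.2.2.2 _ _ (Nat.succ_pos _) (Nat.succ_pos _) fun he =>
        hij (Fin.ext (Nat.succ_injective he))

/-! ### The expected criteria in terms of the statistics -/

section Expected

variable {S : Type*} [MeasurableSpace S] {μ : Measure S} [IsProbabilityMeasure μ]
  {n N : ℕ} {σ : ℝ} {Φ : Matrix (Fin N) (Fin n) ℝ} {P : Matrix (Fin n) (Fin n) ℝ}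
  {V : S → Fin N → ℝ}

/-- Bias-variance decomposition: whiteness removes the cross term and turns the variance into a
trace. -/
theorem mseG_eq (hV : IsWhiteVec μ V σ) (hN : N ≠ 0) (hσ : 0 < σ) (hP : P.PosDef)
    (hG : (Φᵀ * Φ).det ≠ 0) (θ : Fin n → ℝ) :
    mseG μ σ θ V Φ P = ((N : ℝ) ^ 2)⁻¹ * redMseG σ θ (noiselessStat Φ) P
      + σ ^ 2 * ((Φᵀ * Φ)⁻¹).trace := by
  have hN' : (N : ℝ) ≠ 0 := Nat.cast_ne_zero.2 hN
  have ht : ((Rmat σ Φ P)⁻¹ * Φᵀ * ((Rmat σ Φ P)⁻¹ * Φᵀ)ᵀ).trace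
      = ((Rmat σ Φ P)⁻¹ * (Φᵀ * Φ) * (Rmat σ Φ P)⁻¹).trace := by
    rw [Matrix.transpose_mul, Matrix.transpose_transpose, Rmat_inv_transpose hσ hP]
    simp only [Matrix.mul_assoc]
  rw [mseG]
  simp only [rlsEst_sub hσ hP]
  rw [hV.integral_sqNorm, ht, trace_Rmat_gram_Rmat hσ hP hG, ← Matrix.smul_mulVec,
    ← Matrix.neg_mulVec, sqNorm_mulVec, redMseG, noiselessStat, scaledInv_eq hN hσ hP,
    inv_smul_inv hN' hG, Matrix.transpose_neg, Matrix.transpose_smul,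
    Matrix.transpose_mul, Rmat_inv_transpose hσ hP]
  simp only [Matrix.smul_mul, Matrix.mul_smul, smul_smul, Matrix.smul_mulVec, dotProduct_smul,
    Matrix.trace_smul, smul_eq_mul, Matrix.mul_assoc, neg_mul_neg]
  field_simp
  ring

theorem mseY_eq (hV : IsWhiteVec μ V σ) (hN : N ≠ 0) (hσ : 0 < σ) (hP : P.PosDef)
    (θ : Fin n → ℝ) :
    mseY μ σ θ V Φ P = (N : ℝ)⁻¹ * redMseY σ θ (noiselessStat Φ) P + σ ^ 2 * (N + n) := by
  have hN' : (N : ℝ) ≠ 0 := Nat.cast_ne_zero.2 hN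
  set H := Φ * ((Rmat σ Φ P)⁻¹ * Φᵀ) with hH
  -- The prediction error is affine in the stacked vector of both noise copies, itself white, so a
  -- single second-moment formula applies.
  have hform : ∀ z : S × S, Φ *ᵥ θ + V z.2 - Φ *ᵥ rlsEst σ Φ P (Φ *ᵥ θ + V z.1)
      = (σ ^ 2 • (Φ * ((Rmat σ Φ P)⁻¹ * P⁻¹))) *ᵥ θ
        + Matrix.fromCols (-H) 1 *ᵥ Sum.elim (V z.1) (V z.2) := by
    intro z
    have h1 : rlsEst σ Φ P (Φ *ᵥ θ + V z.1) = θ +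
        (-(σ ^ 2 • (((Rmat σ Φ P)⁻¹ * P⁻¹) *ᵥ θ)) + ((Rmat σ Φ P)⁻¹ * Φᵀ) *ᵥ V z.1) := by
      rw [← rlsEst_sub hσ hP]; abel
    rw [h1, Matrix.fromCols_mulVec_sumElim, Matrix.neg_mulVec, Matrix.one_mulVec, hH,
      Matrix.mulVec_add, Matrix.mulVec_add, Matrix.mulVec_neg, Matrix.mulVec_smul,
      Matrix.smul_mulVec, Matrix.mulVec_mulVec, Matrix.mulVec_mulVec]
    abel
  set B : Matrix (Fin N) (Fin N ⊕ Fin N) ℝ := Matrix.fromCols (-H) 1 with hB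
  have ht : (B * Bᵀ).trace = ((Rmat σ Φ P)⁻¹ * (Φᵀ * Φ) * ((Rmat σ Φ P)⁻¹ * (Φᵀ * Φ))).trace + N := by
    have hHt : Hᵀ = H := by
      rw [hH, Matrix.transpose_mul, Matrix.transpose_mul, Matrix.transpose_transpose,
        Rmat_inv_transpose hσ hP, Matrix.mul_assoc]
    rw [hB, Matrix.transpose_fromCols, Matrix.fromCols_mul_fromRows, Matrix.transpose_neg, hHt,
      Matrix.transpose_one, Matrix.trace_add, Matrix.mul_one, Matrix.trace_one,
      Fintype.card_fin, neg_mul_neg, hH, Matrix.mul_assoc Φ, Matrix.trace_mul_comm Φ]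
    simp only [Matrix.mul_assoc]
  rw [mseY]
  simp only [hform]
  rw [hV.prod.integral_sqNorm, ht, trace_Rmat_gram_sq hσ hP, sqNorm_mulVec, redMseY,
    noiselessStat, scaledInv_eq hN hσ hP, Matrix.transpose_smul, Matrix.transpose_mul,
    Matrix.transpose_mul, Rmat_inv_transpose hσ hP]
  simp only [Matrix.smul_mul, Matrix.mul_smul, smul_smul, Matrix.smul_mulVec, dotProduct_smul,
    Matrix.trace_smul, smul_eq_mul, Matrix.mul_assoc]
  field_simp
  ring

/-- The noise contributes `σ² Tr Q⁻¹ = N - n + σ² Tr (R⁻¹ P⁻¹)`; only the last term depends on `P`.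
-/
theorem critEEB_eq (hV : IsWhiteVec μ V σ) (hN : N ≠ 0) (hσ : 0 < σ) (hP : P.PosDef)
    (θ : Fin n → ℝ) :
    critEEB μ σ θ V Φ P = redEEB σ θ (noiselessStat Φ) P
      + (N - n + ((N - n) * Real.log (σ ^ 2) + n * Real.log N)) := by
  have hN' : (N : ℝ) ≠ 0 := Nat.cast_ne_zero.2 hN
  have hs : σ ^ 2 ≠ 0 := by positivity
  have hform : ∀ ω, (Φ *ᵥ θ + V ω) ⬝ᵥ ((Qmat σ Φ P)⁻¹ *ᵥ (Φ *ᵥ θ + V ω))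
      = (Φ *ᵥ θ + (1 : Matrix (Fin N) (Fin N) ℝ) *ᵥ V ω) ⬝ᵥ
        ((Qmat σ Φ P)⁻¹ *ᵥ (Φ *ᵥ θ) + (Qmat σ Φ P)⁻¹ *ᵥ V ω) := by
    intro ω
    rw [Matrix.one_mulVec, Matrix.mulVec_add]
  have ht : σ ^ 2 * ((Qmat σ Φ P)⁻¹).trace
      = N - n + σ ^ 2 * ((Rmat σ Φ P)⁻¹ * P⁻¹).trace := by
    rw [Qmat_inv hσ hP, Matrix.trace_smul, Matrix.trace_sub, Matrix.trace_one, Fintype.card_fin,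
      Matrix.mul_assoc, Matrix.trace_mul_comm, Matrix.mul_assoc, Rmat_inv_mul_gram hσ hP,
      Matrix.trace_sub, Matrix.trace_one, Matrix.trace_smul, Fintype.card_fin, smul_eq_mul,
      smul_eq_mul, mul_inv_cancel_left₀ hs]
    ring
  rw [critEEB]
  simp only [critEB, hform]
  rw [integral_add (hV.integrable_dotProduct _ _ _ _) (integrable_const _),
    hV.integral_dotProduct, integral_const, Matrix.one_mul, Matrix.trace_transpose, ht,
    quad_Qmat_inv hσ hP, redEEB, noiselessStat, redEBCore_eq hN hσ hP, scaledInv_eq hN hσ hP,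
    Matrix.smul_mul, Matrix.trace_smul]
  simp only [probReal_univ, smul_eq_mul]
  field_simp
  ring

end Expected

/-! ### The noise term `Φᵀ V / N` -/

section NoiseTail

variable {S ι : Type*} [MeasurableSpace S] [Fintype ι] [DecidableEq ι] {μ : Measure S}
  [IsProbabilityMeasure μ] {a Z : S → ι → ℝ} {σ B : ℝ}

/-- Independence factors each term `E[aᵢ aₖ Zᵢ Zₖ]`, and whiteness kills the terms `i ≠ k`.
Boundedness of `a` supplies integrability. -/
theorem IsWhiteVec.integral_sq_le_of_bounded (hZ : IsWhiteVec μ Z σ) (ha : Measurable a)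
    (hZm : Measurable Z) (hind : IndepFun a Z μ) (hB : ∀ ω, a ω ⬝ᵥ a ω ≤ B) :
    Integrable (fun ω => (a ω ⬝ᵥ Z ω) ^ 2) μ ∧ ∫ ω, (a ω ⬝ᵥ Z ω) ^ 2 ∂μ ≤ σ ^ 2 * B := by
  have ham : ∀ i, Measurable fun ω => a ω i := fun i => (measurable_pi_apply i).comp ha
  have hZim : ∀ i, Measurable fun ω => Z ω i := fun i => (measurable_pi_apply i).comp hZm
  have hsq : ∀ ω i, a ω i ^ 2 ≤ B := fun ω i => by
    refine le_trans ?_ (hB ω)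
    rw [sq]
    exact Finset.single_le_sum (f := fun i => a ω i * a ω i)
      (fun i _ => mul_self_nonneg _) (Finset.mem_univ i)
  have hbd : ∀ i k ω, ‖a ω i * a ω k‖ ≤ B := fun i k ω => by
    rw [Real.norm_eq_abs, abs_le]
    constructor <;>
      nlinarith [hsq ω i, hsq ω k, sq_nonneg (a ω i - a ω k), sq_nonneg (a ω i + a ω k)]
  have hint : ∀ i k, Integrable (fun ω => (a ω i * a ω k) * (Z ω i * Z ω k)) μ := fun i k =>
    ((hZ.memLp i).integrable_mul (hZ.memLp k)).bdd_mul
      ((ham i).mul (ham k)).aestronglyMeasurable (ae_of_all _ (hbd i k))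
  have hval : ∀ i k, ∫ ω, (a ω i * a ω k) * (Z ω i * Z ω k) ∂μ
      = (∫ ω, a ω i * a ω k ∂μ) * if i = k then σ ^ 2 else 0 := by
    intro i k
    have h := hind.comp (φ := fun x : ι → ℝ => x i * x k) (ψ := fun x : ι → ℝ => x i * x k)
      (by fun_prop) (by fun_prop)
    rw [← hZ.integral_mul i k]
    exact h.integral_fun_mul_eq_mul_integral ((ham i).mul (ham k)).aestronglyMeasurable
      ((hZim i).mul (hZim k)).aestronglyMeasurable
  have hexp : (fun ω => (a ω ⬝ᵥ Z ω) ^ 2)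
      = fun ω => ∑ i, ∑ k, (a ω i * a ω k) * (Z ω i * Z ω k) := by
    funext ω
    rw [sq, dotProduct, Finset.sum_mul_sum]
    exact Finset.sum_congr rfl fun i _ => Finset.sum_congr rfl fun k _ => by ring
  have hi2 : ∀ i ∈ Finset.univ, Integrable
      (fun ω => ∑ k, (a ω i * a ω k) * (Z ω i * Z ω k)) μ := fun i _ =>
    integrable_finsetSum _ fun k _ => hint i k
  have haint : ∀ i ∈ Finset.univ, Integrable (fun ω => a ω i * a ω i) μ := fun i _ =>
    Integrable.of_bound ((ham i).mul (ham i)).aestronglyMeasurable B (ae_of_all _ (hbd i i))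
  have htot : ∫ ω, (a ω ⬝ᵥ Z ω) ^ 2 ∂μ = σ ^ 2 * ∫ ω, a ω ⬝ᵥ a ω ∂μ := by
    rw [hexp, integral_finsetSum _ hi2]
    simp only [dotProduct]
    rw [integral_finsetSum _ haint, Finset.mul_sum]
    refine Finset.sum_congr rfl fun i _ => ?_
    rw [integral_finsetSum _ fun k _ => hint i k]
    simp [hval, mul_comm]
  refine ⟨hexp ▸ integrable_finsetSum _ hi2, ?_⟩
  rw [htot]
  have : ∫ ω, a ω ⬝ᵥ a ω ∂μ ≤ ∫ _, B ∂μ :=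
    integral_mono (integrable_finsetSum _ haint) (integrable_const B) hB
  rw [integral_const] at this
  simp only [probReal_univ, smul_eq_mul, one_mul] at this
  gcongr

/-- Chebyshev's inequality for a linear combination of white noise with random coefficients that
are independent of the noise, on the event that the coefficients are bounded. -/
theorem IsWhiteVec.measure_abs_gt_le (hZ : IsWhiteVec μ Z σ) (ha : Measurable a)
    (hZm : Measurable Z) (hind : IndepFun a Z μ) (hB : 0 ≤ B) {c : ℝ} (hc : 0 < c) :
    μ {ω | a ω ⬝ᵥ a ω ≤ B ∧ c < |a ω ⬝ᵥ Z ω|} ≤ ENNReal.ofReal (σ ^ 2 * B / c ^ 2) := by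
  classical
  have hmeas : Measurable fun x : ι → ℝ => if x ⬝ᵥ x ≤ B then x else 0 := by
    refine Measurable.ite (measurableSet_le ?_ measurable_const) measurable_id measurable_const
    simp only [dotProduct]
    fun_prop
  -- Truncation is a measurable function of `a` alone, so independence of `Z` survives, and no
  -- moment assumption on the input is needed.
  set a' : S → ι → ℝ := fun ω => if a ω ⬝ᵥ a ω ≤ B then a ω else 0 with ha'
  have hind' : IndepFun a' Z μ := hind.comp hmeas measurable_id
  have hB' : ∀ ω, a' ω ⬝ᵥ a' ω ≤ B := by
    intro ω
    simp only [ha']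
    split_ifs with h
    · exact h
    · simpa using hB
  obtain ⟨h1, h2⟩ := hZ.integral_sq_le_of_bounded (hmeas.comp ha) hZm hind' hB'
  have h3 := mul_meas_ge_le_integral_of_nonneg (ae_of_all _ fun ω => sq_nonneg (a' ω ⬝ᵥ Z ω))
    h1 (c ^ 2)
  have h4 : μ.real {ω | c ^ 2 ≤ (a' ω ⬝ᵥ Z ω) ^ 2} ≤ σ ^ 2 * B / c ^ 2 := by
    rw [le_div_iff₀ (by positivity), mul_comm]
    exact h3.trans h2
  refine (measure_mono (t := {ω | c ^ 2 ≤ (a' ω ⬝ᵥ Z ω) ^ 2}) ?_).trans ?_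
  · rintro ω ⟨hω1, hω2⟩
    simp only [Set.mem_ofPred_eq, ha', if_pos hω1]
    rw [← sq_abs (_ ⬝ᵥ _)]
    gcongr
  · rw [← ofReal_measureReal]
    exact ENNReal.ofReal_le_ofReal h4

end NoiseTail

/-! ### Stochastic orders of the statistics and of the estimators -/

section Probability

variable {S : Type*} [MeasurableSpace S] {μ : Measure S} [IsProbabilityMeasure μ]
  {n p : ℕ} {u : ℤ → S → ℝ} {v : ℕ → S → ℝ} {σ : ℝ}

/-- The diagonal entries of `ΦᵀΦ` are the squared norms of the columns of `Φ`; Chebyshev is applied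
to each column, followed by a union bound. -/
theorem exists_measure_noise_gt_le (hu : ∀ t, Measurable (u t)) (hv : ∀ t, Measurable (v t))
    (hwhite : IsWhiteNoise μ v σ)
    (hindep : IndepFun (fun ω t => u t ω) (fun ω t => v t ω) μ) {M ε : ℝ} (hM : 0 ≤ M)
    (hε : 0 < ε) :
    ∃ L : ℝ, 0 < L ∧ ∀ N : ℕ, 1 ≤ N →
      μ {ω | (∀ j, ((regMatrix n u N ω)ᵀ * regMatrix n u N ω) j j ≤ M * N) ∧
        L / √N < ‖(N : ℝ)⁻¹ • ((regMatrix n u N ω)ᵀ *ᵥ noiseVec v N ω)‖} ≤ ENNReal.ofReal ε := by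
  -- Chosen so that the union bound `n * σ² M / L²` is at most `ε`; the `+ 1` keeps `L` positive
  -- when `n * M = 0`.
  set L := √(n * (σ ^ 2 * M) / ε + 1) with hL
  have hLpos : 0 < L := Real.sqrt_pos.2 (by positivity)
  have hLsq : L ^ 2 = n * (σ ^ 2 * M) / ε + 1 := Real.sq_sqrt (by positivity)
  refine ⟨L, hLpos, fun N hN => ?_⟩
  have hN' : (0 : ℝ) < N := by exact_mod_cast hN
  have hsN : 0 < √(N : ℝ) := Real.sqrt_pos.2 hN'
  have hsq : √(N : ℝ) ^ 2 = N := Real.sq_sqrt hN'.le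
  have hcol : ∀ j : Fin n, μ {ω | (regMatrix n u N ω)ᵀ j ⬝ᵥ (regMatrix n u N ω)ᵀ j ≤ M * N ∧
      L * √N < |(regMatrix n u N ω)ᵀ j ⬝ᵥ noiseVec v N ω|}
        ≤ ENNReal.ofReal (σ ^ 2 * M / L ^ 2) := by
    intro j
    have h1 : IndepFun (fun ω => (regMatrix n u N ω)ᵀ j) (noiseVec v N) μ :=
      hindep.comp
        (φ := fun x : ℤ → ℝ => fun i : Fin N => x (((i : ℕ) + 1 : ℤ) - ((j : ℕ) + 1 : ℤ)))
        (ψ := fun x : ℕ → ℝ => fun i : Fin N => x ((i : ℕ) + 1)) (by fun_prop) (by fun_prop)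
    have h2 := (hwhite.isWhiteVec N).measure_abs_gt_le (B := M * N) (c := L * √N)
      (measurable_pi_lambda _ fun i => hu _) (measurable_pi_lambda _ fun i => hv _) h1
      (by positivity) (by positivity)
    have h3 : σ ^ 2 * (M * N) / (L * √N) ^ 2 = σ ^ 2 * M / L ^ 2 := by
      rw [mul_pow, hsq]
      field_simp
    rwa [h3] at h2
  refine (measure_mono (t := ⋃ j : Fin n, {ω |
    (regMatrix n u N ω)ᵀ j ⬝ᵥ (regMatrix n u N ω)ᵀ j ≤ M * N ∧
      L * √N < |(regMatrix n u N ω)ᵀ j ⬝ᵥ noiseVec v N ω|}) ?_).trans ?_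
  · rintro ω ⟨hω1, hω2⟩
    by_contra hcon
    refine absurd hω2 (not_lt.2 ?_)
    rw [pi_norm_le_iff_of_nonneg (by positivity)]
    intro j
    by_contra hlt
    refine hcon (Set.mem_iUnion.2 ⟨j, hω1 j, ?_⟩)
    have h4 := not_le.1 hlt
    rw [Pi.smul_apply, smul_eq_mul, Real.norm_eq_abs, abs_mul, abs_of_pos (inv_pos.2 hN'),
      inv_mul_eq_div, div_lt_div_iff₀ hsN hN'] at h4
    have h5 : L * √N * √N < |(regMatrix n u N ω)ᵀ j ⬝ᵥ noiseVec v N ω| * √N := by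
      rw [mul_assoc, ← sq, hsq]
      exact h4
    exact lt_of_mul_lt_mul_right h5 hsN.le
  · refine (measure_iUnion_fintype_le μ _).trans ((Finset.sum_le_sum fun j _ => hcol j).trans ?_)
    rw [Finset.sum_const, Finset.card_univ, Fintype.card_fin, ← ENNReal.ofReal_nsmul,
      nsmul_eq_mul]
    refine ENNReal.ofReal_le_ofReal ?_
    rw [← mul_div_assoc, div_le_iff₀ (by positivity), hLsq]
    have : ε * (n * (σ ^ 2 * M) / ε + 1) = n * (σ ^ 2 * M) + ε := by field_simp
    linarith

open scoped Matrix.Norms.Frobenius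

theorem abs_apply_le_norm (A : Matrix (Fin n) (Fin n) ℝ) (i j : Fin n) : |A i j| ≤ ‖A‖ := by
  rw [← frobNorm_eq_norm, frobNorm]
  refine Real.abs_le_sqrt ?_
  calc A i j ^ 2 ≤ ∑ k, A i k ^ 2 :=
        Finset.single_le_sum (f := fun k => A i k ^ 2) (fun k _ => sq_nonneg _)
          (Finset.mem_univ j)
    _ ≤ _ := Finset.single_le_sum (f := fun i => ∑ k, A i k ^ 2)
          (fun k _ => Finset.sum_nonneg fun _ _ => sq_nonneg _) (Finset.mem_univ i)

/-- Outside an event of small probability, for large `N`, the Gram matrix is nonsingular, and the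
statistics are close to their limits, at the stated rates. -/
theorem exists_good_event (hu : ∀ t, Measurable (u t)) (hv : ∀ t, Measurable (v t))
    (hwhite : IsWhiteNoise μ v σ)
    (hindep : IndepFun (fun ω t => u t ω) (fun ω t => v t ω) μ)
    {Sig : Matrix (Fin n) (Fin n) ℝ} (hSig : Sig.det ≠ 0)
    {δ : ℕ → ℝ} (hδpos : ∀ N, 0 < δ N) (hδ : Tendsto δ atTop (𝓝 0))
    (hGram : IsBigOp μ (fun N ω => frobNorm
      ((N : ℝ)⁻¹ • ((regMatrix n u N ω)ᵀ * regMatrix n u N ω) - Sig)) δ)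
    {ε : ℝ} (hε : 0 < ε) :
    ∃ L : ℝ, 0 < L ∧ ∀ r : ℝ, 0 < r → ∀ᶠ N : ℕ in atTop, ∃ s : Set S,
      μ s ≤ ENNReal.ofReal ε ∧ ∀ ω ∉ s,
        ((regMatrix n u N ω)ᵀ * regMatrix n u N ω).det ≠ 0 ∧
        ‖(N : ℝ)⁻¹ • ((regMatrix n u N ω)ᵀ * regMatrix n u N ω) - Sig‖ ≤ L * δ N ∧
        ‖(N : ℝ)⁻¹ • ((regMatrix n u N ω)ᵀ *ᵥ noiseVec v N ω)‖ ≤ L / √N ∧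
        L * δ N < r ∧ L / √N < r ∧ (N : ℝ)⁻¹ < r := by
  obtain ⟨L₁, hL₁, h₁⟩ := hGram (ε / 2) (half_pos hε)
  -- Once the normalized Gram matrix is within `1` of `Sig`, its diagonal entries are at most `‖Sig‖
  -- + 1`.
  obtain ⟨L₂, hL₂, h₂⟩ := exists_measure_noise_gt_le (n := n) hu hv hwhite hindep
    (M := ‖Sig‖ + 1) (by positivity) (half_pos hε)
  refine ⟨max L₁ L₂, lt_max_of_lt_left hL₁, fun r hr => ?_⟩
  have hdet : ∀ᶠ A in 𝓝 Sig, A.det ≠ 0 :=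
    (Continuous.matrix_det continuous_id).continuousAt.eventually_ne hSig
  obtain ⟨r', hr', hball⟩ := Metric.eventually_nhds_iff_ball.1 hdet
  have hsqrt : Tendsto (fun N : ℕ => max L₁ L₂ / √(N : ℝ)) atTop (𝓝 0) :=
    tendsto_const_nhds.div_atTop (Real.tendsto_sqrt_atTop.comp tendsto_natCast_atTop_atTop)
  have hLδ : Tendsto (fun N => max L₁ L₂ * δ N) atTop (𝓝 0) := by
    simpa using hδ.const_mul (max L₁ L₂)
  have hinv : Tendsto (fun N : ℕ => (N : ℝ)⁻¹) atTop (𝓝 0) :=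
    tendsto_inv_atTop_zero.comp tendsto_natCast_atTop_atTop
  filter_upwards [eventually_ge_atTop 1, hsqrt.eventually (gt_mem_nhds hr),
    hLδ.eventually (gt_mem_nhds hr), hinv.eventually (gt_mem_nhds hr),
    hLδ.eventually (gt_mem_nhds one_pos), hLδ.eventually (gt_mem_nhds hr')]
    with N hN e1 e2 e3 e4 e5
  have hN' : (0 : ℝ) < N := by exact_mod_cast hN
  have hsN : 0 < √(N : ℝ) := Real.sqrt_pos.2 hN'
  refine ⟨_, (measure_union_le _ _).trans ((add_le_add (h₁ N hN).le (h₂ N hN)).trans ?_), ?_⟩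
  · rw [← ENNReal.ofReal_add (by positivity) (by positivity), add_halves]
  · intro ω hω
    rw [Set.mem_union, not_or] at hω
    have g1 : ‖(N : ℝ)⁻¹ • ((regMatrix n u N ω)ᵀ * regMatrix n u N ω) - Sig‖ ≤ L₁ * δ N := by
      have := hω.1
      rw [Set.mem_ofPred_eq, not_lt, abs_of_pos (hδpos N)] at this
      simpa only [frobNorm_eq_norm, abs_norm] using this
    have g2 : ‖(N : ℝ)⁻¹ • ((regMatrix n u N ω)ᵀ * regMatrix n u N ω) - Sig‖
        ≤ max L₁ L₂ * δ N :=
      g1.trans (mul_le_mul_of_nonneg_right (le_max_left _ _) (hδpos N).le)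
    refine ⟨?_, g2, ?_, e2, e1, e3⟩
    · have := hball ((N : ℝ)⁻¹ • ((regMatrix n u N ω)ᵀ * regMatrix n u N ω))
        (by rw [Metric.mem_ball, dist_eq_norm]; exact g2.trans_lt e5)
      rw [Matrix.det_smul] at this
      exact right_ne_zero_of_mul this
    · by_contra hcon
      refine hω.2 ⟨fun j => ?_, lt_of_le_of_lt ?_ (not_le.1 hcon)⟩
      · have k1 := (abs_le.1 ((abs_apply_le_norm _ j j).trans (g2.trans e4.le))).2
        have k2 := (abs_le.1 (abs_apply_le_norm Sig j j)).2
        rw [Matrix.sub_apply, Matrix.smul_apply, smul_eq_mul, inv_mul_eq_div] at k1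
        have k3 : ((regMatrix n u N ω)ᵀ * regMatrix n u N ω) j j / N ≤ ‖Sig‖ + 1 := by linarith
        exact (div_le_iff₀ hN').1 k3
      · gcongr
        exact le_max_right _ _

omit [IsProbabilityMeasure μ] in
/-- An estimator that minimizes, up to scaling and additive constants, a smooth function of the
hyperparameter and of statistics `x`, whose value at nearby statistics `x'` is the limit criterion
up to a constant, converges to the minimizers of the latter at the rate of `x - x'`. -/
theorem isBigOp_infDist_argminOn {X : Type*} [NormedAddCommGroup X] [NormedSpace ℝ X]
    {Θ : Set (Hyper p)} (hΘ : IsCompact Θ)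
    {W : Hyper p → ℝ} (hW : ∀ η ∈ Θ, ContDiffAt ℝ 2 W η) (hN : NondegMinimizers Θ W)
    {F : X × Hyper p → ℝ} {x₀ : X} (hF : ∀ η ∈ Θ, ContDiffAt ℝ 2 F (x₀, η))
    {J : ℕ → S → Hyper p → ℝ} {η : ℕ → S → Hyper p}
    (hη : IsEstimator μ n u Θ J η) (hint : AsympInterior μ Θ η)
    {x x' : ℕ → S → X} {a : ℕ → ℝ} (ha : ∀ N, 1 ≤ N → 0 < a N)
    (hJ : ∀ N, 1 ≤ N → ∀ ω, ((regMatrix n u N ω)ᵀ * regMatrix n u N ω).det ≠ 0 →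
      ∃ c > 0, ∃ d, ∀ ζ ∈ Θ, J N ω ζ = c * F (x N ω, ζ) + d)
    (hx' : ∀ N ω, ∃ c, ∀ ζ ∈ Θ, F (x' N ω, ζ) = W ζ + c)
    (hclose : ∀ ε : ℝ, 0 < ε → ∃ L : ℝ, 0 < L ∧ ∀ r : ℝ, 0 < r → ∀ᶠ N : ℕ in atTop,
      ∃ s : Set S, μ s ≤ ENNReal.ofReal ε ∧ ∀ ω ∉ s,
        ((regMatrix n u N ω)ᵀ * regMatrix n u N ω).det ≠ 0 ∧
        x N ω ∈ Metric.ball x₀ r ∧ x' N ω ∈ Metric.ball x₀ r ∧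
        ‖x N ω - x' N ω‖ ≤ L * a N) :
    IsBigOp μ (fun N ω => Metric.infDist (η N ω) (argminOn Θ W)) a := by
  intro ε hε
  have hε3 : 0 < ε / 3 := by positivity
  obtain ⟨L, hL, hclose⟩ := hclose (ε / 3) hε3
  obtain ⟨r, hr, C, hC, hpert⟩ := exists_infDist_argminOn_le hΘ hW hN hF
  obtain ⟨N₀, hN₀⟩ := eventually_atTop.1 ((hclose r hr).and
    (hint.eventually (gt_mem_nhds (ENNReal.ofReal_pos.2 hε3))))
  set d := Metric.diam Θ
  have hd : 0 ≤ d := Metric.diam_nonneg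
  have hsum : 0 ≤ ∑ N ∈ Finset.range N₀, d / |a N| :=
    Finset.sum_nonneg fun N _ => by positivity
  have hcont : ContinuousOn W Θ := fun ζ hζ => (hW ζ hζ).continuousAt.continuousWithinAt
  -- `C * L` serves large `N`. The sum covers the finitely many `N < N₀`, where the distance is
  -- almost surely at most the diameter `d`.
  refine ⟨C * L + 1 + ∑ N ∈ Finset.range N₀, d / |a N|, by positivity, fun N h1N => ?_⟩
  have haN := ha N h1N
  have hae := hη N h1N
  by_cases hlt : N < N₀
  · have hterm : d / |a N| ≤ ∑ N ∈ Finset.range N₀, d / |a N| :=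
      Finset.single_le_sum (f := fun N => d / |a N|) (fun N _ => by positivity)
        (Finset.mem_range.2 hlt)
    have hdle : d ≤ (C * L + 1 + ∑ N ∈ Finset.range N₀, d / |a N|) * |a N| := by
      calc d = d / |a N| * |a N| := by rw [div_mul_cancel₀ _ (abs_pos.2 haN.ne').ne']
        _ ≤ _ := by
          gcongr
          have : 0 ≤ C * L := by positivity
          linarith
    have hnull : μ {ω | (C * L + 1 + ∑ N ∈ Finset.range N₀, d / |a N|) * |a N|
        < |Metric.infDist (η N ω) (argminOn Θ W)|} = 0 := by
      refine measure_mono_null ?_ (ae_iff.1 hae)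
      intro ω hω hgood
      refine absurd hω (not_lt.2 (le_trans ?_ hdle))
      obtain ⟨b, hb⟩ := argminOn_nonempty hΘ ⟨_, hgood.1⟩ hcont
      rw [abs_of_nonneg Metric.infDist_nonneg]
      exact (Metric.infDist_le_dist_of_mem hb).trans
        (Metric.dist_le_diam_of_mem hΘ.isBounded hgood.1 hb.1)
    rw [hnull]
    exact ENNReal.ofReal_pos.2 hε
  · obtain ⟨⟨s, hs, hgood⟩, hi⟩ := hN₀ N (not_lt.1 hlt)
    have hsub : {ω | (C * L + 1 + ∑ N ∈ Finset.range N₀, d / |a N|) * |a N|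
        < |Metric.infDist (η N ω) (argminOn Θ W)|} ⊆ (s ∪ {ω | η N ω ∉ interior Θ}) ∪
          {ω | ¬(η N ω ∈ Θ ∧ (((regMatrix n u N ω)ᵀ * regMatrix n u N ω).det ≠ 0 →
            η N ω ∈ argminOn Θ (J N ω)))} := by
      intro ω hω
      by_contra hcon
      simp only [Set.mem_union, Set.mem_ofPred_eq, not_or, not_not] at hcon
      obtain ⟨⟨k1, k2⟩, -, k4⟩ := hcon
      obtain ⟨g1, g2, g3, g4⟩ := hgood ω k1
      obtain ⟨c, hc, e, hce⟩ := hJ N h1N ω g1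
      obtain ⟨e', he'⟩ := hx' N ω
      have harg : η N ω ∈ argminOn Θ fun ζ => F (x N ω, ζ) := by
        refine ⟨(k4 g1).1, fun ζ hζ => ?_⟩
        have := (k4 g1).2 ζ hζ
        rw [hce _ (k4 g1).1, hce ζ hζ] at this
        exact le_of_mul_le_mul_left (by linarith) hc
      have hfin := hpert _ g2 _ g3 e' he' _ harg k2
      rw [Set.mem_ofPred_eq] at hω
      refine absurd hω (not_lt.2 ?_)
      rw [abs_of_nonneg Metric.infDist_nonneg, abs_of_pos haN]
      calc _ ≤ C * ‖x N ω - x' N ω‖ := hfin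
        _ ≤ C * (L * a N) := by gcongr
        _ ≤ _ := by nlinarith [mul_nonneg hsum haN.le]
    calc _ ≤ μ s + μ {ω | η N ω ∉ interior Θ} + 0 := by
          refine (measure_mono hsub).trans ((measure_union_le _ _).trans ?_)
          exact add_le_add (measure_union_le _ _) (ae_iff.1 hae).le
      _ ≤ ENNReal.ofReal (ε / 3) + ENNReal.ofReal (ε / 3) := by
          rw [add_zero]
          exact add_le_add hs hi.le
      _ = ENNReal.ofReal (ε / 3 + ε / 3) := (ENNReal.ofReal_add hε3.le hε3.le).symm
      _ < ENNReal.ofReal ε := (ENNReal.ofReal_lt_ofReal_iff hε).2 (by linarith)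

end Probability

/-! ### Closeness of the statistics to their limits -/

section Closeness

open scoped Matrix.Norms.Frobenius

variable {S : Type*} [MeasurableSpace S] {n : ℕ}

theorem norm_sub_stat_le {A A' : Matrix (Fin n) (Fin n) ℝ} {s s' : ℝ} {b b' : Fin n → ℝ} {c : ℝ}
    (hA : ‖A - A'‖ ≤ c) (hs : |s - s'| ≤ c) (hb : ‖b - b'‖ ≤ c) :
    ‖((A, s, b) : Stat n) - (A', s', b')‖ ≤ c :=
  max_le hA (max_le hs hb)

theorem stat_mem_ball {A A' : Matrix (Fin n) (Fin n) ℝ} {s s' : ℝ} {b b' : Fin n → ℝ} {r : ℝ}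
    (hA : ‖A - A'‖ < r) (hs : |s - s'| < r) (hb : ‖b - b'‖ < r) :
    ((A, s, b) : Stat n) ∈ Metric.ball (A', s', b') r := by
  rw [Metric.mem_ball, dist_eq_norm]
  exact max_lt hA (max_lt hs hb)

theorem inv_le_inv_sqrt {N : ℕ} (hN : 1 ≤ N) : (N : ℝ)⁻¹ ≤ 1 / √N := by
  have hN' : (1 : ℝ) ≤ N := by exact_mod_cast hN
  have h0 : 0 < √(N : ℝ) := Real.sqrt_pos.2 (by linarith)
  rw [one_div]
  refine inv_anti₀ h0 ?_
  nlinarith [Real.sq_sqrt (by linarith : (0 : ℝ) ≤ N), Real.one_le_sqrt.2 hN']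

/-- The statistics, with or without the noise component, are close to `(Σ, 0, 0)`, at a rate that
depends on that of the Gram matrix, and to `(Φᵀ Φ / N, 0, 0)`, at a rate that does not. -/
theorem stat_closeness {μ : Measure S} [IsProbabilityMeasure μ]
    {u : ℤ → S → ℝ} {v : ℕ → S → ℝ} {σ : ℝ}
    (hu : ∀ t, Measurable (u t)) (hv : ∀ t, Measurable (v t))
    (hwhite : IsWhiteNoise μ v σ)
    (hindep : IndepFun (fun ω t => u t ω) (fun ω t => v t ω) μ)
    {Sig : Matrix (Fin n) (Fin n) ℝ} (hSig : Sig.det ≠ 0)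
    {δ : ℕ → ℝ} (hδpos : ∀ N, 0 < δ N) (hδ : Tendsto δ atTop (𝓝 0))
    (hGram : IsBigOp μ (fun N ω => frobNorm
      ((N : ℝ)⁻¹ • ((regMatrix n u N ω)ᵀ * regMatrix n u N ω) - Sig)) δ)
    {ε : ℝ} (hε : 0 < ε) :
    ∃ L : ℝ, 0 < L ∧ ∀ r : ℝ, 0 < r → ∀ᶠ N : ℕ in atTop, ∃ s : Set S,
      μ s ≤ ENNReal.ofReal ε ∧ ∀ ω ∉ s,
        ((regMatrix n u N ω)ᵀ * regMatrix n u N ω).det ≠ 0 ∧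
        noiselessStat (regMatrix n u N ω) ∈ Metric.ball ((Sig, 0, 0) : Stat n) r ∧
        stat (regMatrix n u N ω) (noiseVec v N ω) ∈ Metric.ball ((Sig, 0, 0) : Stat n) r ∧
        (((N : ℝ)⁻¹ • ((regMatrix n u N ω)ᵀ * regMatrix n u N ω), 0, 0) : Stat n)
          ∈ Metric.ball ((Sig, 0, 0) : Stat n) r ∧
        ‖noiselessStat (regMatrix n u N ω) - (Sig, 0, 0)‖ ≤ L * max (δ N) (1 / (N : ℝ)) ∧
        ‖stat (regMatrix n u N ω) (noiseVec v N ω) - (Sig, 0, 0)‖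
          ≤ L * max (δ N) (1 / √(N : ℝ)) ∧
        ‖noiselessStat (regMatrix n u N ω)
          - ((N : ℝ)⁻¹ • ((regMatrix n u N ω)ᵀ * regMatrix n u N ω), 0, 0)‖
          ≤ L * (1 / (N : ℝ)) ∧
        ‖stat (regMatrix n u N ω) (noiseVec v N ω)
          - ((N : ℝ)⁻¹ • ((regMatrix n u N ω)ᵀ * regMatrix n u N ω), 0, 0)‖
          ≤ L * (1 / √(N : ℝ)) := by
  obtain ⟨L, hL, h⟩ := exists_good_event hu hv hwhite hindep hSig hδpos hδ hGram hε
  refine ⟨max L 1, by positivity, fun r hr => ?_⟩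
  filter_upwards [h r hr, eventually_ge_atTop 1] with N ⟨s, hs, hgood⟩ hN
  refine ⟨s, hs, fun ω hω => ?_⟩
  obtain ⟨g1, g2, g3, g4, g5, g6⟩ := hgood ω hω
  have hN0 : (0 : ℝ) ≤ (N : ℝ)⁻¹ := by positivity
  have hL1 : 1 ≤ max L 1 := le_max_right _ _
  have hLL : L ≤ max L 1 := le_max_left _ _
  have hδ0 := (hδpos N).le
  have hs0 : 0 ≤ 1 / √(N : ℝ) := by positivity
  have hNs := inv_le_inv_sqrt hN
  have hinv : (N : ℝ)⁻¹ = 1 / (N : ℝ) := (one_div _).symm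
  have b1 : ‖(N : ℝ)⁻¹ • ((regMatrix n u N ω)ᵀ * regMatrix n u N ω) - Sig‖ < r :=
    g2.trans_lt g4
  have b2 : |(N : ℝ)⁻¹ - 0| < r := by rwa [sub_zero, abs_of_nonneg hN0]
  have b3 : ‖(N : ℝ)⁻¹ • ((regMatrix n u N ω)ᵀ *ᵥ noiseVec v N ω) - 0‖ < r := by
    rw [sub_zero]; exact g3.trans_lt g5
  have b4 : ‖(0 : Fin n → ℝ) - 0‖ < r := by simpa using hr
  have b5 : |(0 : ℝ) - 0| < r := by simpa using hr
  have c1 : ∀ c, ‖(N : ℝ)⁻¹ • ((regMatrix n u N ω)ᵀ * regMatrix n u N ω) - Sig‖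
      ≤ max L 1 * max (δ N) c := fun c =>
    g2.trans (mul_le_mul hLL (le_max_left _ _) hδ0 (by positivity))
  have c2 : ∀ c, (N : ℝ)⁻¹ ≤ c → |(N : ℝ)⁻¹ - 0| ≤ max L 1 * c := fun c hc => by
    rw [sub_zero, abs_of_nonneg hN0]
    nlinarith
  have c3 : ∀ c, 1 / √(N : ℝ) ≤ c →
      ‖(N : ℝ)⁻¹ • ((regMatrix n u N ω)ᵀ *ᵥ noiseVec v N ω) - 0‖ ≤ max L 1 * c :=
    fun c hc => by
      rw [sub_zero]
      refine g3.trans ?_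
      rw [div_eq_mul_one_div]
      exact mul_le_mul hLL hc hs0 (by positivity)
  have c4 : ∀ c, 0 ≤ c → ‖(0 : Fin n → ℝ) - 0‖ ≤ max L 1 * c := fun c hc => by
    rw [sub_zero, norm_zero]; positivity
  have c5 : ∀ c, 0 ≤ c → ‖(N : ℝ)⁻¹ • ((regMatrix n u N ω)ᵀ * regMatrix n u N ω)
      - (N : ℝ)⁻¹ • ((regMatrix n u N ω)ᵀ * regMatrix n u N ω)‖ ≤ max L 1 * c := fun c hc => by
    rw [sub_self, norm_zero]; positivity
  refine ⟨g1, stat_mem_ball b1 b2 b4, stat_mem_ball b1 b2 b3, stat_mem_ball b1 b5 b4,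
    norm_sub_stat_le (c1 _) (c2 _ (hinv ▸ le_max_right _ _)) (c4 _ (le_max_of_le_left hδ0)),
    norm_sub_stat_le (c1 _) (c2 _ (hNs.trans (le_max_right _ _))) (c3 _ (le_max_right _ _)),
    norm_sub_stat_le (c5 _ (hinv ▸ hN0)) (c2 _ hinv.le) (c4 _ (hinv ▸ hN0)),
    norm_sub_stat_le (c5 _ hs0) (c2 _ hNs) (c3 _ le_rfl)⟩

end Closeness

end FIR

end

/-! ### Assembly of the six rates -/

theorem mainTheorem2
    {S : Type*} [MeasurableSpace S] (μ : Measure S) [IsProbabilityMeasure μ]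
    (n p : ℕ)
    -- input, noise and true parameter
    (u : ℤ → S → ℝ) (v : ℕ → S → ℝ) (θ₀ : Fin n → ℝ) (σ : ℝ)
    (hσ : 0 < σ)
    (hu : ∀ t, Measurable (u t)) (hv : ∀ t, Measurable (v t))
    (hwhite : FIR.IsWhiteNoise μ v σ)
    (hindep : IndepFun (fun ω t => u t ω) (fun ω t => v t ω) μ)
    -- limit of the normalized Gram matrix, with rate
    (Sig : Matrix (Fin n) (Fin n) ℝ) (hSig : Sig.PosDef)
    (δ : ℕ → ℝ) (hδpos : ∀ N, 0 < δ N) (hδ : Tendsto δ atTop (𝓝 0))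
    (hGram : FIR.IsBigOp μ
      (fun N ω => FIR.frobNorm
        ((N : ℝ)⁻¹ • ((FIR.regMatrix n u N ω)ᵀ * FIR.regMatrix n u N ω) - Sig)) δ)
    -- parametrization of the kernel matrix
    (Θ U : Set (FIR.Hyper p)) (hΘ : IsCompact Θ) (hU : IsOpen U) (hΘU : Θ ⊆ U)
    (P : FIR.Hyper p → Matrix (Fin n) (Fin n) ℝ)
    (hPsmooth : ∀ i j, ContDiffOn ℝ 2 (fun η => P η i j) U)
    (hPpos : ∀ η ∈ Θ, (P η).PosDef)
    -- the limit criteria have isolated, nondegenerate minimizers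
    (hWg : FIR.NondegMinimizers Θ (fun η => FIR.limG σ Sig θ₀ (P η)))
    (hWy : FIR.NondegMinimizers Θ (fun η => FIR.limY σ Sig θ₀ (P η)))
    (hWB : FIR.NondegMinimizers Θ (fun η => FIR.limB θ₀ (P η)))
    -- the six hyperparameter estimators
    (ηMSEg ηSg ηMSEy ηSy ηEEB ηEB : ℕ → S → FIR.Hyper p)
    (hMSEg : FIR.IsEstimator μ n u Θ (fun N ω η =>
      FIR.mseG μ σ θ₀ (FIR.noiseVec v N) (FIR.regMatrix n u N ω) (P η)) ηMSEg)
    (hSg : FIR.IsEstimator μ n u Θ (fun N ω η =>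
      FIR.sureG σ (FIR.regMatrix n u N ω) (FIR.outputVec u v θ₀ N ω) (P η)) ηSg)
    (hMSEy : FIR.IsEstimator μ n u Θ (fun N ω η =>
      FIR.mseY μ σ θ₀ (FIR.noiseVec v N) (FIR.regMatrix n u N ω) (P η)) ηMSEy)
    (hSy : FIR.IsEstimator μ n u Θ (fun N ω η =>
      FIR.sureY σ (FIR.regMatrix n u N ω) (FIR.outputVec u v θ₀ N ω) (P η)) ηSy)
    (hEEB : FIR.IsEstimator μ n u Θ (fun N ω η =>
      FIR.critEEB μ σ θ₀ (FIR.noiseVec v N) (FIR.regMatrix n u N ω) (P η)) ηEEB)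
    (hEB : FIR.IsEstimator μ n u Θ (fun N ω η =>
      FIR.critEB σ (FIR.regMatrix n u N ω) (FIR.outputVec u v θ₀ N ω) (P η)) ηEB)
    -- they are asymptotically interior points of the feasible set
    (hMSEgInt : FIR.AsympInterior μ Θ ηMSEg) (hSgInt : FIR.AsympInterior μ Θ ηSg)
    (hMSEyInt : FIR.AsympInterior μ Θ ηMSEy) (hSyInt : FIR.AsympInterior μ Θ ηSy)
    (hEEBInt : FIR.AsympInterior μ Θ ηEEB) (hEBInt : FIR.AsympInterior μ Θ ηEB) :
    FIR.IsBigOp μ (fun N ω => Metric.infDist (ηMSEg N ω)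
        (FIR.argminOn Θ fun η => FIR.limG σ Sig θ₀ (P η)))
      (fun N => max (δ N) (1 / (N : ℝ))) ∧
    FIR.IsBigOp μ (fun N ω => Metric.infDist (ηSg N ω)
        (FIR.argminOn Θ fun η => FIR.limG σ Sig θ₀ (P η)))
      (fun N => max (δ N) (1 / √(N : ℝ))) ∧
    FIR.IsBigOp μ (fun N ω => Metric.infDist (ηMSEy N ω)
        (FIR.argminOn Θ fun η => FIR.limY σ Sig θ₀ (P η)))
      (fun N => max (δ N) (1 / (N : ℝ))) ∧
    FIR.IsBigOp μ (fun N ω => Metric.infDist (ηSy N ω)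
        (FIR.argminOn Θ fun η => FIR.limY σ Sig θ₀ (P η)))
      (fun N => max (δ N) (1 / √(N : ℝ))) ∧
    FIR.IsBigOp μ (fun N ω => Metric.infDist (ηEEB N ω)
        (FIR.argminOn Θ fun η => FIR.limB θ₀ (P η)))
      (fun N => 1 / (N : ℝ)) ∧
    FIR.IsBigOp μ (fun N ω => Metric.infDist (ηEB N ω)
        (FIR.argminOn Θ fun η => FIR.limB θ₀ (P η)))
      (fun N => 1 / √(N : ℝ)) := by
  open scoped Matrix.Norms.Frobenius in
  have hSd : Sig.det ≠ 0 := hSig.det_pos.ne'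
  have hPd : ∀ η ∈ Θ, (P η).det ≠ 0 := fun η hη => (hPpos η hη).det_pos.ne'
  have hPC : ∀ η ∈ Θ, ContDiffAt ℝ 2 P η := fun η hη =>
    FIR.contDiffAt_matrix fun i j => (hPsmooth i j).contDiffAt (hU.mem_nhds (hΘU hη))
  -- Smoothness of the limit criteria is inherited from the reduced ones by freezing the statistics.
  have hslice : ∀ F : FIR.Stat n × FIR.Hyper p → ℝ, (∀ η ∈ Θ, ContDiffAt ℝ 2 F ((Sig, 0, 0), η)) →
      ∀ η ∈ Θ, ContDiffAt ℝ 2 (fun ζ => F ((Sig, 0, 0), ζ)) η := fun F hF η hη =>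
    (hF η hη).comp η (contDiffAt_const.prodMk contDiffAt_id)
  have hFMg : ∀ η ∈ Θ, ContDiffAt ℝ 2 (fun z : FIR.Stat n × FIR.Hyper p =>
      FIR.redMseG σ θ₀ z.1 (P z.2)) ((Sig, 0, 0), η) := fun η hη =>
    FIR.contDiffAt_redMseG σ θ₀ hSd (hPC η hη) (hPd η hη)
  have hFSg : ∀ η ∈ Θ, ContDiffAt ℝ 2 (fun z : FIR.Stat n × FIR.Hyper p =>
      FIR.redSureG σ θ₀ z.1 (P z.2)) ((Sig, 0, 0), η) := fun η hη =>
    FIR.contDiffAt_redSureG σ θ₀ hSd (hPC η hη) (hPd η hη)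
  have hFMy : ∀ η ∈ Θ, ContDiffAt ℝ 2 (fun z : FIR.Stat n × FIR.Hyper p =>
      FIR.redMseY σ θ₀ z.1 (P z.2)) ((Sig, 0, 0), η) := fun η hη =>
    FIR.contDiffAt_redMseY σ θ₀ hSd (hPC η hη) (hPd η hη)
  have hFSy : ∀ η ∈ Θ, ContDiffAt ℝ 2 (fun z : FIR.Stat n × FIR.Hyper p =>
      FIR.redSureY σ θ₀ z.1 (P z.2)) ((Sig, 0, 0), η) := fun η hη =>
    FIR.contDiffAt_redSureY σ θ₀ hSd (hPC η hη) (hPd η hη)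
  have hFEEB : ∀ η ∈ Θ, ContDiffAt ℝ 2 (fun z : FIR.Stat n × FIR.Hyper p =>
      FIR.redEEB σ θ₀ z.1 (P z.2)) ((Sig, 0, 0), η) := fun η hη =>
    FIR.contDiffAt_redEEB σ θ₀ hSd (hPC η hη) (hPd η hη)
  have hFEB : ∀ η ∈ Θ, ContDiffAt ℝ 2 (fun z : FIR.Stat n × FIR.Hyper p =>
      FIR.redEB σ θ₀ z.1 (P z.2)) ((Sig, 0, 0), η) := fun η hη =>
    FIR.contDiffAt_redEB σ θ₀ hSd (hPC η hη) (hPd η hη)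
  have hCg : ∀ η ∈ Θ, ContDiffAt ℝ 2 (fun ζ => FIR.limG σ Sig θ₀ (P ζ)) η := by
    simpa only [FIR.redSureG_zero] using hslice _ hFSg
  have hCy : ∀ η ∈ Θ, ContDiffAt ℝ 2 (fun ζ => FIR.limY σ Sig θ₀ (P ζ)) η := by
    simpa only [FIR.redSureY_zero _ _ _ _ hSd] using hslice _ hFSy
  have hCB : ∀ η ∈ Θ, ContDiffAt ℝ 2 (fun ζ => FIR.limB θ₀ (P ζ)) η := fun η hη => by
    have h := (hslice _ hFEB η hη).sub (contDiffAt_const (c := Real.log Sig.det))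
    simpa only [FIR.redEB_zero, add_sub_cancel_right] using h
  have hV := fun N => hwhite.isWhiteVec N
  have hgood : ∀ ε : ℝ, 0 < ε → _ := fun ε hε =>
    FIR.stat_closeness hu hv hwhite hindep hSd hδpos hδ hGram hε
  have hpos : ∀ N : ℕ, 1 ≤ N → (0 : ℝ) < N := fun N hN => by exact_mod_cast hN
  refine ⟨?_, ?_, ?_, ?_, ?_, ?_⟩
  · refine FIR.isBigOp_infDist_argminOn hΘ hCg hWg hFMg hMSEg hMSEgInt
      (x := fun N ω => FIR.noiselessStat (FIR.regMatrix n u N ω)) (x' := fun _ _ => (Sig, 0, 0))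
      (fun N _ => lt_max_of_lt_left (hδpos N))
      (fun N hN ω hG => ⟨((N : ℝ) ^ 2)⁻¹, inv_pos.2 (pow_pos (hpos N hN) 2), _, fun ζ hζ =>
        FIR.mseG_eq (hV N) (by omega) hσ (hPpos ζ hζ) hG θ₀⟩)
      (fun _ _ => ⟨0, fun ζ _ => by simp only [FIR.redMseG_zero, add_zero]⟩) fun ε hε => ?_
    obtain ⟨L, hL, h⟩ := hgood ε hε
    refine ⟨L, hL, fun r hr => (h r hr).mono fun N ⟨s, hs, h⟩ => ⟨s, hs, fun ω hω => ?_⟩⟩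
    obtain ⟨g, b1, b2, b3, c1, c2, c3, c4⟩ := h ω hω
    exact ⟨g, b1, Metric.mem_ball_self hr, c1⟩
  · refine FIR.isBigOp_infDist_argminOn hΘ hCg hWg hFSg hSg hSgInt
      (x := fun N ω => FIR.stat (FIR.regMatrix n u N ω) (FIR.noiseVec v N ω))
      (x' := fun _ _ => (Sig, 0, 0)) (fun N _ => lt_max_of_lt_left (hδpos N))
      (fun N hN ω hG => ⟨((N : ℝ) ^ 2)⁻¹, inv_pos.2 (pow_pos (hpos N hN) 2), _, fun ζ hζ =>
        FIR.sureG_eq (by omega) hσ (hPpos ζ hζ) hG θ₀ _⟩)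
      (fun _ _ => ⟨0, fun ζ _ => by simp only [FIR.redSureG_zero, add_zero]⟩) fun ε hε => ?_
    obtain ⟨L, hL, h⟩ := hgood ε hε
    refine ⟨L, hL, fun r hr => (h r hr).mono fun N ⟨s, hs, h⟩ => ⟨s, hs, fun ω hω => ?_⟩⟩
    obtain ⟨g, b1, b2, b3, c1, c2, c3, c4⟩ := h ω hω
    exact ⟨g, b2, Metric.mem_ball_self hr, c2⟩
  · refine FIR.isBigOp_infDist_argminOn hΘ hCy hWy hFMy hMSEy hMSEyInt
      (x := fun N ω => FIR.noiselessStat (FIR.regMatrix n u N ω)) (x' := fun _ _ => (Sig, 0, 0))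
      (fun N _ => lt_max_of_lt_left (hδpos N))
      (fun N hN ω hG => ⟨(N : ℝ)⁻¹, inv_pos.2 (hpos N hN), _, fun ζ hζ =>
        FIR.mseY_eq (hV N) (by omega) hσ (hPpos ζ hζ) θ₀⟩)
      (fun _ _ => ⟨0, fun ζ _ => by simp only [FIR.redMseY_zero _ _ _ _ hSd, add_zero]⟩)
      fun ε hε => ?_
    obtain ⟨L, hL, h⟩ := hgood ε hε
    refine ⟨L, hL, fun r hr => (h r hr).mono fun N ⟨s, hs, h⟩ => ⟨s, hs, fun ω hω => ?_⟩⟩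
    obtain ⟨g, b1, b2, b3, c1, c2, c3, c4⟩ := h ω hω
    exact ⟨g, b1, Metric.mem_ball_self hr, c1⟩
  · refine FIR.isBigOp_infDist_argminOn hΘ hCy hWy hFSy hSy hSyInt
      (x := fun N ω => FIR.stat (FIR.regMatrix n u N ω) (FIR.noiseVec v N ω))
      (x' := fun _ _ => (Sig, 0, 0)) (fun N _ => lt_max_of_lt_left (hδpos N))
      (fun N hN ω hG => ⟨(N : ℝ)⁻¹, inv_pos.2 (hpos N hN), _, fun ζ hζ =>
        FIR.sureY_eq (by omega) hσ (hPpos ζ hζ) hG θ₀ _⟩)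
      (fun _ _ => ⟨0, fun ζ _ => by simp only [FIR.redSureY_zero _ _ _ _ hSd, add_zero]⟩)
      fun ε hε => ?_
    obtain ⟨L, hL, h⟩ := hgood ε hε
    refine ⟨L, hL, fun r hr => (h r hr).mono fun N ⟨s, hs, h⟩ => ⟨s, hs, fun ω hω => ?_⟩⟩
    obtain ⟨g, b1, b2, b3, c1, c2, c3, c4⟩ := h ω hω
    exact ⟨g, b2, Metric.mem_ball_self hr, c2⟩
  · refine FIR.isBigOp_infDist_argminOn hΘ hCB hWB hFEEB hEEB hEEBInt
      (x := fun N ω => FIR.noiselessStat (FIR.regMatrix n u N ω))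
      -- The reference point carries the observed Gram matrix, so `x - x'` has only the component
      -- `1/N`; `δ` is needed only to place both points in the ball.
      (x' := fun N ω => ((N : ℝ)⁻¹ • ((FIR.regMatrix n u N ω)ᵀ * FIR.regMatrix n u N ω), 0, 0))
      (fun N hN => one_div_pos.2 (hpos N hN))
      (fun N hN ω hG => ⟨1, one_pos, _, fun ζ hζ => by
        rw [one_mul]
        exact FIR.critEEB_eq (hV N) (by omega) hσ (hPpos ζ hζ) θ₀⟩)
      (fun _ _ => ⟨_, fun ζ _ => FIR.redEEB_zero σ θ₀ _ (P ζ)⟩) fun ε hε => ?_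
    obtain ⟨L, hL, h⟩ := hgood ε hε
    refine ⟨L, hL, fun r hr => (h r hr).mono fun N ⟨s, hs, h⟩ => ⟨s, hs, fun ω hω => ?_⟩⟩
    obtain ⟨g, b1, b2, b3, c1, c2, c3, c4⟩ := h ω hω
    exact ⟨g, b1, b3, c3⟩
  · refine FIR.isBigOp_infDist_argminOn hΘ hCB hWB hFEB hEB hEBInt
      (x := fun N ω => FIR.stat (FIR.regMatrix n u N ω) (FIR.noiseVec v N ω))
      -- Same reference point; the noise component now remains in `x - x'` and sets the rate `1/√N`.
      (x' := fun N ω => ((N : ℝ)⁻¹ • ((FIR.regMatrix n u N ω)ᵀ * FIR.regMatrix n u N ω), 0, 0))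
      (fun N hN => one_div_pos.2 (Real.sqrt_pos.2 (hpos N hN)))
      (fun N hN ω hG => ⟨1, one_pos, _, fun ζ hζ => by
        rw [one_mul]
        exact FIR.critEB_eq (by omega) hσ (hPpos ζ hζ) hG θ₀ _⟩)
      (fun _ _ => ⟨_, fun ζ _ => FIR.redEB_zero σ θ₀ _ (P ζ)⟩) fun ε hε => ?_
    obtain ⟨L, hL, h⟩ := hgood ε hε
    refine ⟨L, hL, fun r hr => (h r hr).mono fun N ⟨s, hs, h⟩ => ⟨s, hs, fun ω hω => ?_⟩⟩
    obtain ⟨g, b1, b2, b3, c1, c2, c3, c4⟩ := h ω hω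
    exact ⟨g, b2, b3, c4⟩
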